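/- Let $\mathbf k$ be a commutative $\mathbb Q$-algebra and let $A$ be a unital associative $\mathbf k$-algebra such that $\mathbf k\to A$ is a $\mathbf k$-split injection. Let $\Omega$ be the dg algebra of noncommutative differential forms of $A$ and let $\Omega_t=\Omega *_{\mathbf k}\mathbf k[t]$, bigraded by de Rham degree $p$ and degree $q$ in $t$, with differential $d$ satisfying $dt=0$. Let $i_t$ be the odd superderivation of $\Omega_t$ with $i_t(a)=0$, $i_t(t)=0$, $i_t(da)=[a,t]$ for $a\in A$. Put $\overline{DR}=\Omega/([\Omega,\Omega]+\mathbf k)$ and $\overline{DR}_t=\Omega_t/([\Omega_t,\Omega_t]+\mathbf k[t])$ (supercommutators), with the induced bigradings and anticommuting differentials $d$, $i_t$, and identify $\overline{DR}$ with the part of $\overline{DR}_t$ of degree $0$ in $t$. Let $\overline{DR}{}_t^+$ be the part of positive degree in $t$. Let $\overline{HD}_n(A)$ be the homology of $(\overline{DR},d)$ in degree $n$. Let $R=\mathbf k((u))/u\mathbf k[[u]]$, let $\overline{EHC}(A)=H(\overline{DR}_t\otimes R,\ i_t-ud)$, and for $\ell,m\in\mathbb Z$ let $\overline{EHC}_\ell(A,m)$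 be the homology in homological degree $\ell$ of the subcomplex of internal degree $\ell-m$, where $\overline{DR}{}_t^{p,q}u^{-r}$ has homological degree $p+2r$ and internal degree $p+q+r$. Then $\overline{EHC}_\ell(A,m)\to\overline{EHC}(A)$ is injective, and the assignments $$\pi_m:\ \sum_{j\ge0}f_ju^{-j}\mapsto f_m \bmod t,\qquad \pi_-:\ \sum_{j\ge0}f_ju^{-j}\mapsto f_0 \bmod \operatorname{im} d$$ induce isomorphisms $$\pi_m:\overline{EHC}_\ell(A,m)\to\overline{HD}_{\ell-2m}(A)\ (m>0),\qquad \pi_-:\overline{EHC}_\ell(A,m)\to H(\overline{DR}_t/d\overline{DR}_t,\ i_t)^{\ell,-m}\ (m\le 0).$$ Let $\tilde d^{-1}:d\overline{DR}{}_t^+\to\overline{DR}{}_t^+$ be any set-theoretic section of $d:\overline{DR}{}_t^+\to d\overline{DR}{}_t^+$. Let $f$ be either a closed form in $\overline{DR}$ of degree $\ell-2m$ (when $m>0$), or an element of $\overline{DR}_t$ whose class in $\overline{DR}_t/d\overline{DR}_t$ has bidegree $(\ell,-m)$ and is killed by $i_t$ (when $m\le0$). Then all the terms $(\tilde d^{-1}i_t)^j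 f$, $j\ge0$, are defined. If $\tilde d^{-1}$ lowers the de Rham degree by at least one (it maps elements of de Rham degree $\le p+1$ to elements of de Rham degree $\le p$, for all $p$), then $(\mathrm{Id}-u^{-1}\tilde d^{-1}i_t)^{-1}f=\sum_{j\ge0}u^{-j}(\tilde d^{-1}i_t)^jf$ is a finite sum. Whenever this sum is finite, then * for $m>0$, the element $u^{-m}(\mathrm{Id}-u^{-1}\tilde d^{-1}i_t)^{-1}f$ is a cycle, and its class in $\overline{EHC}(A)$ is the image of $\pi_m^{-1}[f]$; * for $m\le0$, the element $(\mathrm{Id}-u^{-1}\tilde d^{-1}i_t)^{-1}f$ is a cycle, and its class in $\overline{EHC}(A)$ is the image of $\pi_-^{-1}[f]$. In particular these classes do not depend on the choice of $\tilde d^{-1}$, and they depend on $f$ only through its class. -/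

import Mathlib

set_option linter.unnecessarySeqFocus false

namespace NCForms

universe v w

section Algebra

/-! Noncommutative forms.  For a set `X` of extra variables, `Forms k A X` is the differential
graded algebra `Ω A *_k k⟨X⟩`, in which every `x ∈ X` has degree `0` and `dx = 0`.
It is given by generators `a`, `da` (`a ∈ A`) and `x` (`x ∈ X`).
For `X = ∅` this is `Ω A`, and for a one-point set `X = {t}` it is
`Ω_t A = Ω (A *_k k[t]) / (dt) = Ω A *_k k[t]`. -/

/-- The generators: `a`, `da` and the extra variables. -/
inductive Gen (A : Type w) (X : Type) : Type w
  | of (a : A) : Gen A X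
  | diff (a : A) : Gen A X
  | var (x : X) : Gen A X

/-- De Rham degree of a generator. -/
def Gen.deg {A : Type w} {X : Type} : Gen A X → ℤ
  | .of _ => 0
  | .diff _ => 1
  | .var _ => 0

/-- Degree of a generator in the extra variables. -/
def Gen.wt {A : Type w} {X : Type} : Gen A X → ℤ
  | .of _ => 0
  | .diff _ => 0
  | .var _ => 1

variable (k : Type v) [CommRing k] (A : Type w) [Ring A] [Algebra k A] (X : Type)

/-- The defining relations: `a ↦ a` is a unital `k`-algebra map, `a ↦ da` is `k`-linear,
kills `1` (so it is defined on `A / k`) and satisfies the Leibniz rule. -/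
inductive Rel : FreeAlgebra k (Gen A X) → FreeAlgebra k (Gen A X) → Prop
  | of_add (a b : A) : Rel (FreeAlgebra.ι k (Gen.of (a + b)))
      (FreeAlgebra.ι k (Gen.of a) + FreeAlgebra.ι k (Gen.of b))
  | of_smul (r : k) (a : A) : Rel (FreeAlgebra.ι k (Gen.of (r • a)))
      (r • FreeAlgebra.ι k (Gen.of a))
  | of_one : Rel (FreeAlgebra.ι k (Gen.of 1)) 1
  | of_mul (a b : A) : Rel (FreeAlgebra.ι k (Gen.of (a * b)))
      (FreeAlgebra.ι k (Gen.of a) * FreeAlgebra.ι k (Gen.of b))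
  | diff_add (a b : A) : Rel (FreeAlgebra.ι k (Gen.diff (a + b)))
      (FreeAlgebra.ι k (Gen.diff a) + FreeAlgebra.ι k (Gen.diff b))
  | diff_smul (r : k) (a : A) : Rel (FreeAlgebra.ι k (Gen.diff (r • a)))
      (r • FreeAlgebra.ι k (Gen.diff a))
  | diff_one : Rel (FreeAlgebra.ι k (Gen.diff 1)) 0
  | diff_mul (a b : A) : Rel (FreeAlgebra.ι k (Gen.diff (a * b)))
      (FreeAlgebra.ι k (Gen.diff a) * FreeAlgebra.ι k (Gen.of b)
        + FreeAlgebra.ι k (Gen.of a) * FreeAlgebra.ι k (Gen.diff b))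

/-- The algebra of noncommutative forms with extra variables `X`. -/
def Forms : Type (max v w) := RingQuot (Rel k A X)

noncomputable instance : Ring (Forms k A X) := inferInstanceAs (Ring (RingQuot (Rel k A X)))

noncomputable instance : Algebra k (Forms k A X) :=
  inferInstanceAs (Algebra k (RingQuot (Rel k A X)))

/-- The class of a generator. -/
noncomputable def gen (g : Gen A X) : Forms k A X :=
  RingQuot.mkAlgHom k (Rel k A X) (FreeAlgebra.ι k g)

variable {k A X}

theorem rel_eq {x y : FreeAlgebra k (Gen A X)} (h : Rel k A X x y) :
    (RingQuot.mkAlgHom k (Rel k A X) x : Forms k A X) = RingQuot.mkAlgHom k (Rel k A X) y :=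
  RingQuot.mkAlgHom_rel k h

theorem gen_of_one : gen k A X (Gen.of 1) = 1 := (rel_eq Rel.of_one).trans (map_one _)

theorem gen_of_mul (a b : A) :
    gen k A X (Gen.of (a * b)) = gen k A X (Gen.of a) * gen k A X (Gen.of b) :=
  (rel_eq (Rel.of_mul a b)).trans (map_mul _ _ _)

theorem gen_of_add (a b : A) :
    gen k A X (Gen.of (a + b)) = gen k A X (Gen.of a) + gen k A X (Gen.of b) :=
  (rel_eq (Rel.of_add a b)).trans (map_add _ _ _)

theorem gen_of_smul (r : k) (a : A) : gen k A X (Gen.of (r • a)) = r • gen k A X (Gen.of a) :=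
  (rel_eq (Rel.of_smul r a)).trans (map_smul _ _ _)

theorem gen_diff_one : gen k A X (Gen.diff 1) = 0 := (rel_eq Rel.diff_one).trans (map_zero _)

theorem gen_diff_mul (a b : A) :
    gen k A X (Gen.diff (a * b)) = gen k A X (Gen.diff a) * gen k A X (Gen.of b)
      + gen k A X (Gen.of a) * gen k A X (Gen.diff b) :=
  (rel_eq (Rel.diff_mul a b)).trans ((map_add _ _ _).trans
    (congrArg₂ (· + ·) (map_mul _ _ _) (map_mul _ _ _)))

theorem gen_diff_add (a b : A) :
    gen k A X (Gen.diff (a + b)) = gen k A X (Gen.diff a) + gen k A X (Gen.diff b) :=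
  (rel_eq (Rel.diff_add a b)).trans (map_add _ _ _)

theorem gen_diff_smul (r : k) (a : A) :
    gen k A X (Gen.diff (r • a)) = r • gen k A X (Gen.diff a) :=
  (rel_eq (Rel.diff_smul r a)).trans (map_smul _ _ _)

/-- The universal property of `Forms`. -/
noncomputable def lift {B : Type*} [Ring B] [Algebra k B] (φ : A →ₐ[k] B) (ψ : A →ₗ[k] B)
    (hψ1 : ψ 1 = 0) (hψ : ∀ a b, ψ (a * b) = ψ a * φ b + φ a * ψ b) (χ : X → B) :
    Forms k A X →ₐ[k] B :=
  RingQuot.liftAlgHom k ⟨FreeAlgebra.lift k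
    (fun g : Gen A X => match g with
      | .of a => φ a
      | .diff a => ψ a
      | .var x => χ x), by
    intro x y h
    cases h <;> simp [hψ1, hψ]⟩

section lift

variable {B : Type*} [Ring B] [Algebra k B] (φ : A →ₐ[k] B) (ψ : A →ₗ[k] B)
    (hψ1 : ψ 1 = 0) (hψ : ∀ a b, ψ (a * b) = ψ a * φ b + φ a * ψ b) (χ : X → B)

theorem lift_gen_of (a : A) : lift φ ψ hψ1 hψ χ (gen k A X (Gen.of a)) = φ a := by
  unfold lift gen
  exact (RingQuot.liftAlgHom_mkAlgHom_apply _ _ _ _).trans (by simp)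

theorem lift_gen_diff (a : A) : lift φ ψ hψ1 hψ χ (gen k A X (Gen.diff a)) = ψ a := by
  unfold lift gen
  exact (RingQuot.liftAlgHom_mkAlgHom_apply _ _ _ _).trans (by simp)

theorem lift_gen_var (x : X) : lift φ ψ hψ1 hψ χ (gen k A X (Gen.var x)) = χ x := by
  unfold lift gen
  exact (RingQuot.liftAlgHom_mkAlgHom_apply _ _ _ _).trans (by simp)

end lift

variable (k A X)

/-- The algebra map `A → Forms k A X`. -/
noncomputable def ofHom : A →ₐ[k] Forms k A X :=
  AlgHom.ofLinearMap
    { toFun := fun a => gen k A X (Gen.of a)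
      map_add' := gen_of_add
      map_smul' := gen_of_smul } gen_of_one gen_of_mul

/-- The linear map `a ↦ da`. -/
noncomputable def diffHom : A →ₗ[k] Forms k A X where
  toFun := fun a => gen k A X (Gen.diff a)
  map_add' := gen_diff_add
  map_smul' := gen_diff_smul

/-- The product of a word in the generators. -/
noncomputable def word (l : List (Gen A X)) : Forms k A X := (l.map (gen k A X)).prod

/-- The component of de Rham degree `p` and degree `q` in the extra variables. -/
noncomputable def bideg (p q : ℤ) : Submodule k (Forms k A X) :=
  Submodule.span k {y | ∃ l : List (Gen A X),
    (l.map Gen.deg).sum = p ∧ (l.map Gen.wt).sum = q ∧ y = word k A X l}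

/-- The component of de Rham degree `p`. -/
noncomputable def deg (p : ℤ) : Submodule k (Forms k A X) := ⨆ q : ℤ, bideg k A X p q

/-- `[Ω, Ω]`: the span of the supercommutators of forms that are homogeneous
in the de Rham degree. -/
noncomputable def commutators : Submodule k (Forms k A X) :=
  Submodule.span k {y | ∃ p r : ℤ, ∃ a ∈ deg k A X p, ∃ b ∈ deg k A X r,
    y = a * b - ((p * r).negOnePow : ℤˣ) • (b * a)}

variable {k A X}

theorem word_mem_bideg (l : List (Gen A X)) :
    word k A X l ∈ bideg k A X (l.map Gen.deg).sum (l.map Gen.wt).sum :=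
  Submodule.subset_span ⟨l, rfl, rfl, rfl⟩

theorem bideg_le_deg (p q : ℤ) : bideg k A X p q ≤ deg k A X p :=
  le_iSup (fun q => bideg k A X p q) q

theorem word_mem_deg (l : List (Gen A X)) :
    word k A X l ∈ deg k A X (l.map Gen.deg).sum := bideg_le_deg _ _ (word_mem_bideg l)

/-- Linear maps may be controlled on `bideg` through words. -/
theorem map_bideg {M : Type*} [AddCommGroup M] [Module k M] (f : Forms k A X →ₗ[k] M)
    {p q : ℤ} (N : Submodule k M)
    (h : ∀ l : List (Gen A X), (l.map Gen.deg).sum = p → (l.map Gen.wt).sum = q →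
      f (word k A X l) ∈ N) {x : Forms k A X} (hx : x ∈ bideg k A X p q) : f x ∈ N := by
  have : bideg k A X p q ≤ N.comap f := by
    refine Submodule.span_le.2 ?_
    rintro _ ⟨l, h1, h2, rfl⟩
    exact h l h1 h2
  exact this hx

theorem map_deg {M : Type*} [AddCommGroup M] [Module k M] (f : Forms k A X →ₗ[k] M)
    {p : ℤ} (N : Submodule k M)
    (h : ∀ l : List (Gen A X), (l.map Gen.deg).sum = p →
      f (word k A X l) ∈ N) {x : Forms k A X} (hx : x ∈ deg k A X p) : f x ∈ N := by
  have : deg k A X p ≤ N.comap f :=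
    iSup_le fun q _ hy => map_bideg f N (fun l h1 _ => h l h1) hy
  exact this hx

theorem word_cons (g : Gen A X) (l : List (Gen A X)) :
    word k A X (g :: l) = gen k A X g * word k A X l := by simp [word]

theorem word_singleton (g : Gen A X) : word k A X [g] = gen k A X g := by simp [word]

theorem word_append (l l' : List (Gen A X)) :
    word k A X (l ++ l') = word k A X l * word k A X l' := by simp [word]

theorem mul_mem_bideg {p q p' q' : ℤ} {x y : Forms k A X} (hx : x ∈ bideg k A X p q)
    (hy : y ∈ bideg k A X p' q') : x * y ∈ bideg k A X (p + p') (q + q') := by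
  refine map_bideg (LinearMap.mulRight k y) _ ?_ hx
  intro l h1 h2
  refine map_bideg (LinearMap.mulLeft k (word k A X l)) _ ?_ hy
  intro l' h1' h2'
  refine Submodule.subset_span ⟨l ++ l', ?_, ?_, ?_⟩ <;> simp [h1, h2, h1', h2', word_append]

theorem span_word : Submodule.span k (Set.range (word k A X)) = ⊤ := by
  have key : ∀ x : FreeAlgebra k (Gen A X), (RingQuot.mkAlgHom k (Rel k A X) x : Forms k A X) ∈
      Submodule.span k (Set.range (word k A X)) := by
    intro x
    induction x using FreeAlgebra.induction with
    | grade0 r =>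
      have h1 : (1 : Forms k A X) ∈ Submodule.span k (Set.range (word k A X)) :=
        Submodule.subset_span ⟨[], by simp [word]⟩
      have h2 : (RingQuot.mkAlgHom k (Rel k A X) (algebraMap k _ r) : Forms k A X)
          = r • (1 : Forms k A X) := by
        rw [← Algebra.algebraMap_eq_smul_one]
        exact AlgHom.commutes _ r
      rw [h2]
      exact Submodule.smul_mem _ _ h1
    | grade1 g => exact Submodule.subset_span ⟨[g], word_singleton g⟩
    | mul a b ha hb =>
      have h2 : (RingQuot.mkAlgHom k (Rel k A X) (a * b) : Forms k A X)
          = (RingQuot.mkAlgHom k (Rel k A X) a : Forms k A X)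
            * (RingQuot.mkAlgHom k (Rel k A X) b : Forms k A X) := map_mul _ _ _
      rw [h2]
      refine (?_ : Submodule.span k (Set.range (word k A X)) *
        Submodule.span k (Set.range (word k A X)) ≤ _) (Submodule.mul_mem_mul ha hb)
      rw [Submodule.span_mul_span]
      refine Submodule.span_mono ?_
      rintro _ ⟨_, ⟨l, rfl⟩, _, ⟨l', rfl⟩, rfl⟩
      exact ⟨l ++ l', word_append l l'⟩
    | add a b ha hb =>
      have h2 : (RingQuot.mkAlgHom k (Rel k A X) (a + b) : Forms k A X)
          = (RingQuot.mkAlgHom k (Rel k A X) a : Forms k A X)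
            + (RingQuot.mkAlgHom k (Rel k A X) b : Forms k A X) := map_add _ _ _
      rw [h2]
      exact Submodule.add_mem _ ha hb
  refine eq_top_iff.2 fun x _ => ?_
  obtain ⟨y, rfl⟩ := RingQuot.mkAlgHom_surjective k (Rel k A X) x
  exact key y

/-- A linear map on forms is determined on words. -/
theorem linearMap_induction {M : Type*} [AddCommGroup M] [Module k M]
    (f : Forms k A X →ₗ[k] M) (N : Submodule k M) (h : ∀ l, f (word k A X l) ∈ N)
    (x : Forms k A X) : f x ∈ N := by
  have : (⊤ : Submodule k (Forms k A X)) ≤ N.comap f := by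
    rw [← span_word]
    refine Submodule.span_le.2 ?_
    rintro _ ⟨l, rfl⟩
    exact h l
  exact this trivial

/-! ### Odd superderivations -/

/-- The algebra map `x ↦ (ε x, D x; 0, x)`, where `ε` is the parity automorphism and `D` is the
odd superderivation with `D a = α a`, `D (da) = β a` and `D x = 0` for the extra variables. -/
noncomputable def superDerMat (α β : A →ₗ[k] Forms k A X)
    (hα1 : α 1 = 0) (hα : ∀ a b, α (a * b) = α a * ofHom k A X b + ofHom k A X a * α b)
    (hβ1 : β 1 = 0) (hβ : ∀ a b, β (a * b) = β a * ofHom k A X b - diffHom k A X a * α b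
      + α a * diffHom k A X b + ofHom k A X a * β b) :
    Forms k A X →ₐ[k] Matrix (Fin 2) (Fin 2) (Forms k A X) :=
  lift
    (AlgHom.ofLinearMap
      { toFun := fun a => !![ofHom k A X a, α a; 0, ofHom k A X a]
        map_add' := fun a b => by ext i j; fin_cases i <;> fin_cases j <;> simp
        map_smul' := fun r a => by ext i j; fin_cases i <;> fin_cases j <;> simp }
      (by ext i j; fin_cases i <;> fin_cases j <;> simp [hα1])
      (fun a b => by
        ext i j; fin_cases i <;> fin_cases j <;> simp [hα, add_comm]))
    { toFun := fun a => !![-diffHom k A X a, β a; 0, diffHom k A X a]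
      map_add' := fun a b => by ext i j; fin_cases i <;> fin_cases j <;> simp [add_comm]
      map_smul' := fun r a => by ext i j; fin_cases i <;> fin_cases j <;> simp }
    (by
      have h : diffHom k A X 1 = 0 := gen_diff_one
      ext i j; fin_cases i <;> fin_cases j <;> simp [h, hβ1])
    (fun a b => by
      have h : diffHom k A X (a * b) = diffHom k A X a * ofHom k A X b
        + ofHom k A X a * diffHom k A X b := gen_diff_mul a b
      ext i j; fin_cases i <;> fin_cases j <;> simp [h, hβ] <;> abel)
    (fun x => !![gen k A X (Gen.var x), 0; 0, gen k A X (Gen.var x)])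

/-- The odd superderivation `D` with `D a = α a`, `D (da) = β a` and `D x = 0`. -/
noncomputable def superDer (α β : A →ₗ[k] Forms k A X)
    (hα1 : α 1 = 0) (hα : ∀ a b, α (a * b) = α a * ofHom k A X b + ofHom k A X a * α b)
    (hβ1 : β 1 = 0) (hβ : ∀ a b, β (a * b) = β a * ofHom k A X b - diffHom k A X a * α b
      + α a * diffHom k A X b + ofHom k A X a * β b) :
    Forms k A X →ₗ[k] Forms k A X where
  toFun := fun x => superDerMat α β hα1 hα hβ1 hβ x 0 1
  map_add' := fun x y => by simp
  map_smul' := fun r x => by simp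


section superDer

variable (α β : A →ₗ[k] Forms k A X)
    (hα1 : α 1 = 0) (hα : ∀ a b, α (a * b) = α a * ofHom k A X b + ofHom k A X a * α b)
    (hβ1 : β 1 = 0) (hβ : ∀ a b, β (a * b) = β a * ofHom k A X b - diffHom k A X a * α b
      + α a * diffHom k A X b + ofHom k A X a * β b)

theorem superDerMat_of (a : A) : superDerMat α β hα1 hα hβ1 hβ (gen k A X (Gen.of a)) =
    !![gen k A X (Gen.of a), α a; 0, gen k A X (Gen.of a)] := lift_gen_of _ _ _ _ _ a

theorem superDerMat_diff (a : A) : superDerMat α β hα1 hα hβ1 hβ (gen k A X (Gen.diff a)) =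
    !![-gen k A X (Gen.diff a), β a; 0, gen k A X (Gen.diff a)] := lift_gen_diff _ _ _ _ _ a

theorem superDerMat_var (x : X) : superDerMat α β hα1 hα hβ1 hβ (gen k A X (Gen.var x)) =
    !![gen k A X (Gen.var x), 0; 0, gen k A X (Gen.var x)] := lift_gen_var _ _ _ _ _ x

theorem superDerMat_gen_10 (g : Gen A X) :
    superDerMat α β hα1 hα hβ1 hβ (gen k A X g) 1 0 = 0 := by
  cases g <;> simp [superDerMat_of, superDerMat_diff, superDerMat_var]

theorem superDerMat_gen_11 (g : Gen A X) :
    superDerMat α β hα1 hα hβ1 hβ (gen k A X g) 1 1 = gen k A X g := by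
  cases g <;> simp [superDerMat_of, superDerMat_diff, superDerMat_var]

theorem superDerMat_gen_00 (g : Gen A X) :
    superDerMat α β hα1 hα hβ1 hβ (gen k A X g) 0 0 = g.deg.negOnePow • gen k A X g := by
  cases g <;> simp [superDerMat_of, superDerMat_diff, superDerMat_var, Gen.deg, Units.smul_def]

theorem superDerMat_word (l : List (Gen A X)) :
    superDerMat α β hα1 hα hβ1 hβ (word k A X l) 1 0 = 0 ∧
    superDerMat α β hα1 hα hβ1 hβ (word k A X l) 1 1 = word k A X l ∧
    superDerMat α β hα1 hα hβ1 hβ (word k A X l) 0 0 =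
      (l.map Gen.deg).sum.negOnePow • word k A X l := by
  induction l with
  | nil => simp [word]
  | cons g l ih =>
    obtain ⟨h1, h2, h3⟩ := ih
    rw [word_cons, map_mul]
    refine ⟨?_, ?_, ?_⟩
    · simp [Matrix.mul_apply, h1, superDerMat_gen_10]
    · simp [Matrix.mul_apply, h2, superDerMat_gen_10, superDerMat_gen_11]
    · simp [Matrix.mul_apply, h1, h3, superDerMat_gen_00, Int.negOnePow_add,
        smul_mul_smul_comm]

theorem superDerMat_11 (x : Forms k A X) :
    superDerMat α β hα1 hα hβ1 hβ x 1 1 = x := by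
  have := linearMap_induction
    ((Matrix.entryLinearMap k (Forms k A X) (1 : Fin 2) (1 : Fin 2)).comp
      (superDerMat α β hα1 hα hβ1 hβ).toLinearMap - LinearMap.id) ⊥
    (fun l => by simp [superDerMat_word]) x
  simpa [sub_eq_zero] using this

theorem superDerMat_00 {p : ℤ} {x : Forms k A X} (hx : x ∈ deg k A X p) :
    superDerMat α β hα1 hα hβ1 hβ x 0 0 = p.negOnePow • x := by
  have key := map_deg
    ((Matrix.entryLinearMap k (Forms k A X) (0 : Fin 2) (0 : Fin 2)).comp
      (superDerMat α β hα1 hα hβ1 hβ).toLinearMap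
        - DistribSMul.toLinearMap k (Forms k A X) ((p.negOnePow : ℤˣ) : ℤ)) ⊥
    (fun l hl => by
      have h3 := (superDerMat_word α β hα1 hα hβ1 hβ l).2.2
      rw [hl, Units.smul_def] at h3
      rw [Submodule.mem_bot, LinearMap.sub_apply, sub_eq_zero]
      exact h3) hx
  rw [Submodule.mem_bot, LinearMap.sub_apply, sub_eq_zero] at key
  rw [Units.smul_def]
  exact key

/-- The graded Leibniz rule. -/
theorem superDer_mul {p : ℤ} {x : Forms k A X} (hx : x ∈ deg k A X p) (y : Forms k A X) :
    superDer α β hα1 hα hβ1 hβ (x * y) =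
      superDer α β hα1 hα hβ1 hβ x * y + p.negOnePow • (x * superDer α β hα1 hα hβ1 hβ y) := by
  simp only [superDer, LinearMap.coe_mk, AddHom.coe_mk, map_mul]
  simp only [Matrix.mul_apply, Fin.sum_univ_two, superDerMat_00 _ _ _ _ _ _ hx, superDerMat_11,
    smul_mul_assoc]
  abel

theorem superDer_of_mul (a : A) (y : Forms k A X) :
    superDer α β hα1 hα hβ1 hβ (gen k A X (Gen.of a) * y) =
      α a * y + gen k A X (Gen.of a) * superDer α β hα1 hα hβ1 hβ y := by
  simp only [superDer, LinearMap.coe_mk, AddHom.coe_mk, map_mul]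
  simp [Matrix.mul_apply, superDerMat_of, superDerMat_11, add_comm]

theorem superDer_diff_mul (a : A) (y : Forms k A X) :
    superDer α β hα1 hα hβ1 hβ (gen k A X (Gen.diff a) * y) =
      β a * y - gen k A X (Gen.diff a) * superDer α β hα1 hα hβ1 hβ y := by
  simp only [superDer, LinearMap.coe_mk, AddHom.coe_mk, map_mul]
  simp [Matrix.mul_apply, superDerMat_diff, superDerMat_11]
  abel

theorem superDer_var_mul (x : X) (y : Forms k A X) :
    superDer α β hα1 hα hβ1 hβ (gen k A X (Gen.var x) * y) =
      gen k A X (Gen.var x) * superDer α β hα1 hα hβ1 hβ y := by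
  simp only [superDer, LinearMap.coe_mk, AddHom.coe_mk, map_mul]
  simp [Matrix.mul_apply, superDerMat_var, superDerMat_11]

theorem superDer_one : superDer α β hα1 hα hβ1 hβ 1 = 0 := by
  simp [superDer]

theorem superDer_of (a : A) : superDer α β hα1 hα hβ1 hβ (gen k A X (Gen.of a)) = α a := by
  simpa [superDer_one] using superDer_of_mul α β hα1 hα hβ1 hβ a 1

theorem superDer_diff (a : A) :
    superDer α β hα1 hα hβ1 hβ (gen k A X (Gen.diff a)) = β a := by
  simpa [superDer_one] using superDer_diff_mul α β hα1 hα hβ1 hβ a 1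

theorem superDer_var (x : X) :
    superDer α β hα1 hα hβ1 hβ (gen k A X (Gen.var x)) = 0 := by
  simpa [superDer_one] using superDer_var_mul α β hα1 hα hβ1 hβ x 1

/-- A superderivation whose values on generators are homogeneous is homogeneous. -/
theorem superDer_mem_bideg {e f : ℤ} (h1 : ∀ a, α a ∈ bideg k A X e f)
    (h2 : ∀ a, β a ∈ bideg k A X (1 + e) f) {p q : ℤ} {x : Forms k A X}
    (hx : x ∈ bideg k A X p q) :
    superDer α β hα1 hα hβ1 hβ x ∈ bideg k A X (p + e) (q + f) := by
  have key : ∀ l : List (Gen A X), superDer α β hα1 hα hβ1 hβ (word k A X l) ∈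
      bideg k A X ((l.map Gen.deg).sum + e) ((l.map Gen.wt).sum + f) := by
    intro l
    induction l with
    | nil => simp [word, superDer_one]
    | cons g l ih =>
      have hg : gen k A X g ∈ bideg k A X g.deg g.wt := by
        simpa [word_singleton] using word_mem_bideg (k := k) [g]
      have h3 := mul_mem_bideg hg ih
      rw [word_cons]
      cases g with
      | of a =>
        rw [superDer_of_mul]
        refine Submodule.add_mem _ ?_ ?_
        · have := mul_mem_bideg (h1 a) (word_mem_bideg (k := k) l)
          convert this using 1 <;> simp [Gen.deg, Gen.wt] <;> ring_nf
        · convert h3 using 1 <;> simp [Gen.deg, Gen.wt]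
      | diff a =>
        rw [superDer_diff_mul]
        refine Submodule.sub_mem _ ?_ ?_
        · have := mul_mem_bideg (h2 a) (word_mem_bideg (k := k) l)
          convert this using 1 <;> simp [Gen.deg, Gen.wt] <;> ring_nf
        · convert h3 using 1 <;> simp [Gen.deg, Gen.wt] <;> ring_nf
      | var x =>
        rw [superDer_var_mul]
        convert h3 using 1 <;> simp [Gen.deg, Gen.wt] <;> ring_nf
  refine map_bideg _ _ ?_ hx
  rintro l rfl rfl
  exact key l

theorem superDer_mem_deg {e f : ℤ} (h1 : ∀ a, α a ∈ bideg k A X e f)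
    (h2 : ∀ a, β a ∈ bideg k A X (1 + e) f) {p : ℤ} {x : Forms k A X}
    (hx : x ∈ deg k A X p) :
    superDer α β hα1 hα hβ1 hβ x ∈ deg k A X (p + e) := by
  refine map_deg _ _ ?_ hx
  rintro l rfl
  exact bideg_le_deg _ _ (superDer_mem_bideg α β hα1 hα hβ1 hβ h1 h2 (word_mem_bideg l))

theorem superDer_mem_commutators {e f : ℤ} (he : Odd e) (h1 : ∀ a, α a ∈ bideg k A X e f)
    (h2 : ∀ a, β a ∈ bideg k A X (1 + e) f) {x : Forms k A X}
    (hx : x ∈ commutators k A X) :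
    superDer α β hα1 hα hβ1 hβ x ∈ commutators k A X := by
  have : commutators k A X ≤ (commutators k A X).comap (superDer α β hα1 hα hβ1 hβ) := by
    refine Submodule.span_le.2 ?_
    rintro _ ⟨p, r, a, ha, b, hb, rfl⟩
    have ha' := superDer_mem_deg α β hα1 hα hβ1 hβ h1 h2 ha
    have hb' := superDer_mem_deg α β hα1 hα hβ1 hβ h1 h2 hb
    have c1 : superDer α β hα1 hα hβ1 hβ a * b
        - ((p + e) * r).negOnePow • (b * superDer α β hα1 hα hβ1 hβ a) ∈ commutators k A X :=
      Submodule.subset_span ⟨_, _, _, ha', _, hb, rfl⟩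
    have c2 : a * superDer α β hα1 hα hβ1 hβ b
        - (p * (r + e)).negOnePow • (superDer α β hα1 hα hβ1 hβ b * a) ∈ commutators k A X :=
      Submodule.subset_span ⟨_, _, _, ha, _, hb', rfl⟩
    have c3 : p.negOnePow • (a * superDer α β hα1 hα hβ1 hβ b
        - (p * (r + e)).negOnePow • (superDer α β hα1 hα hβ1 hβ b * a)) ∈
        commutators k A X := by
      rw [Units.smul_def]
      exact zsmul_mem c2 _
    have hmul : ∀ n : ℤ, (e * n).negOnePow = n.negOnePow := by
      intro n
      rcases Int.even_or_odd n with hn | hn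
      · rw [Int.negOnePow_even _ hn, Int.negOnePow_even _ (hn.mul_left e)]
      · rw [Int.negOnePow_odd _ hn, Int.negOnePow_odd _ (he.mul hn)]
    have s1 : ((p + e) * r).negOnePow = (p * r).negOnePow * r.negOnePow := by
      rw [add_mul, Int.negOnePow_add, hmul]
    have s2 : p.negOnePow * (p * (r + e)).negOnePow = (p * r).negOnePow := by
      rw [mul_add, Int.negOnePow_add, mul_comm p e, hmul, mul_comm, mul_assoc]
      simp
    have c4 := Submodule.add_mem _ c1 c3
    change superDer α β hα1 hα hβ1 hβ _ ∈ commutators k A X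
    convert c4 using 1
    have hz : superDer α β hα1 hα hβ1 hβ ((p * r).negOnePow • (b * a)) =
        (p * r).negOnePow • superDer α β hα1 hα hβ1 hβ (b * a) := by
      rw [Units.smul_def, Units.smul_def, map_zsmul]
    rw [map_sub, hz, superDer_mul α β hα1 hα hβ1 hβ ha, superDer_mul α β hα1 hα hβ1 hβ hb,
      s1, smul_sub, smul_smul, s2, smul_add, smul_smul]
    abel
  exact this hx

end superDer


section superDer

variable (α β : A →ₗ[k] Forms k A X)
    (hα1 : α 1 = 0) (hα : ∀ a b, α (a * b) = α a * ofHom k A X b + ofHom k A X a * α b)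
    (hβ1 : β 1 = 0) (hβ : ∀ a b, β (a * b) = β a * ofHom k A X b - diffHom k A X a * α b
      + α a * diffHom k A X b + ofHom k A X a * β b)

theorem superDer_scalar {x : Forms k A X}
    (hx : x ∈ Algebra.adjoin k (Set.range fun v : X => gen k A X (Gen.var v))) :
    superDer α β hα1 hα hβ1 hβ x = 0 := by
  have key : ∀ y, superDer α β hα1 hα hβ1 hβ (x * y)
      = x * superDer α β hα1 hα hβ1 hβ y := by
    induction hx using Algebra.adjoin_induction with
    | mem x hx =>
      obtain ⟨v, rfl⟩ := hx
      exact superDer_var_mul α β hα1 hα hβ1 hβ v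
    | algebraMap r =>
      intro y
      rw [← Algebra.smul_def, ← Algebra.smul_def, map_smul]
    | add x y _ _ h1 h2 =>
      intro z
      rw [add_mul, add_mul, map_add, h1, h2]
    | mul x y _ _ h1 h2 =>
      intro z
      rw [mul_assoc, h1, h2, mul_assoc]
  simpa [superDer_one] using key 1

end superDer

variable (k A X)

/-- The Karoubi-de Rham differential: the odd superderivation
with `a ↦ da`, `da ↦ 0`, `x ↦ 0`. -/
noncomputable def dForms : Forms k A X →ₗ[k] Forms k A X :=
  superDer (diffHom k A X) 0 gen_diff_one gen_diff_mul rfl (by simp)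

/-- The variable `t` of `Ω_t A`. -/
noncomputable def tVar : Forms k A Unit := gen k A Unit (Gen.var ())

/-- The linear map `a ↦ [a, t]`. -/
noncomputable def bracketT : A →ₗ[k] Forms k A Unit :=
  (LinearMap.mulRight k (tVar k A) - LinearMap.mulLeft k (tVar k A)).comp
    (ofHom k A Unit).toLinearMap

theorem bracketT_apply (a : A) : bracketT k A a =
    gen k A Unit (Gen.of a) * tVar k A - tVar k A * gen k A Unit (Gen.of a) := rfl

theorem bracketT_one : bracketT k A 1 = 0 := by
  simp [bracketT]

theorem bracketT_mul (a b : A) : bracketT k A (a * b) =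
    bracketT k A a * ofHom k A Unit b + ofHom k A Unit a * bracketT k A b := by
  simp only [bracketT, LinearMap.comp_apply, LinearMap.sub_apply, LinearMap.mulRight_apply,
    LinearMap.mulLeft_apply, AlgHom.toLinearMap_apply, map_mul]
  noncomm_ring

/-- The contraction `i_t` on `Ω_t A`: the odd superderivation
with `t ↦ 0`, `a ↦ 0`, `da ↦ [a, t]`. -/
noncomputable def iForms : Forms k A Unit →ₗ[k] Forms k A Unit :=
  superDer 0 (bracketT k A) rfl (by simp) (bracketT_one k A) (by simp [bracketT_mul])

/-- The image of `k⟨X⟩` in the forms: `k` when `X = ∅`, and `k[t]` when `X = {t}`. -/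
noncomputable def scalars : Submodule k (Forms k A X) :=
  Subalgebra.toSubmodule (Algebra.adjoin k (Set.range fun v : X => gen k A X (Gen.var v)))

variable {k A X}

theorem gen_mem_bideg (g : Gen A X) : gen k A X g ∈ bideg k A X g.deg g.wt := by
  simpa [word_singleton] using word_mem_bideg (k := k) [g]

theorem dForms_mem_bideg {p q : ℤ} {x : Forms k A X} (hx : x ∈ bideg k A X p q) :
    dForms k A X x ∈ bideg k A X (p + 1) q := by
  have := superDer_mem_bideg (diffHom k A X) 0 gen_diff_one gen_diff_mul rfl (by simp)
    (e := 1) (f := 0) (fun a => gen_mem_bideg (Gen.diff a)) (fun a => zero_mem _) hx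
  rwa [add_zero] at this

theorem bracketT_mem (a : A) : bracketT k A a ∈ bideg k A Unit (1 + -1) 1 := by
  have h1 : gen k A Unit (Gen.of a) ∈ bideg k A Unit 0 0 := gen_mem_bideg (Gen.of a)
  have h2 : tVar k A ∈ bideg k A Unit 0 1 := gen_mem_bideg (Gen.var ())
  rw [bracketT_apply]
  have h3 := mul_mem_bideg h1 h2
  have h4 := mul_mem_bideg h2 h1
  rw [show (1 + -1 : ℤ) = 0 by norm_num]
  rw [zero_add, zero_add] at h3
  rw [zero_add, add_zero] at h4
  exact Submodule.sub_mem _ h3 h4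

theorem iForms_mem_bideg {p q : ℤ} {x : Forms k A Unit} (hx : x ∈ bideg k A Unit p q) :
    iForms k A x ∈ bideg k A Unit (p - 1) (q + 1) :=
  superDer_mem_bideg 0 (bracketT k A) rfl (by simp) (bracketT_one k A) (by simp [bracketT_mul])
    (e := -1) (f := 1) (fun a => zero_mem _) bracketT_mem hx

theorem dForms_mem_commutators {x : Forms k A X} (hx : x ∈ commutators k A X) :
    dForms k A X x ∈ commutators k A X :=
  superDer_mem_commutators (diffHom k A X) 0 gen_diff_one gen_diff_mul rfl (by simp)
    (e := 1) (f := 0) (by decide) (fun a => gen_mem_bideg (Gen.diff a)) (fun a => zero_mem _) hx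

theorem iForms_mem_commutators {x : Forms k A Unit} (hx : x ∈ commutators k A Unit) :
    iForms k A x ∈ commutators k A Unit :=
  superDer_mem_commutators 0 (bracketT k A) rfl (by simp) (bracketT_one k A)
    (by simp [bracketT_mul]) (e := -1) (f := 1) (by decide) (fun a => zero_mem _) bracketT_mem hx

theorem dForms_of_mul (a : A) (y : Forms k A X) : dForms k A X (gen k A X (Gen.of a) * y) =
    gen k A X (Gen.diff a) * y + gen k A X (Gen.of a) * dForms k A X y :=
  superDer_of_mul ..

theorem dForms_diff_mul (a : A) (y : Forms k A X) :
    dForms k A X (gen k A X (Gen.diff a) * y) = -(gen k A X (Gen.diff a) * dForms k A X y) :=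
  (superDer_diff_mul ..).trans (by simp [dForms])

theorem dForms_var_mul (v : X) (y : Forms k A X) :
    dForms k A X (gen k A X (Gen.var v) * y) = gen k A X (Gen.var v) * dForms k A X y :=
  superDer_var_mul ..

theorem dForms_one : dForms k A X 1 = 0 := superDer_one ..

theorem iForms_of_mul (a : A) (y : Forms k A Unit) :
    iForms k A (gen k A Unit (Gen.of a) * y) = gen k A Unit (Gen.of a) * iForms k A y :=
  (superDer_of_mul ..).trans (by simp [iForms])

theorem iForms_diff_mul (a : A) (y : Forms k A Unit) :
    iForms k A (gen k A Unit (Gen.diff a) * y) =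
      (gen k A Unit (Gen.of a) * tVar k A - tVar k A * gen k A Unit (Gen.of a)) * y
        - gen k A Unit (Gen.diff a) * iForms k A y :=
  superDer_diff_mul ..

theorem iForms_t_mul (y : Forms k A Unit) :
    iForms k A (tVar k A * y) = tVar k A * iForms k A y :=
  superDer_var_mul ..

theorem iForms_var_mul (v : Unit) (y : Forms k A Unit) :
    iForms k A (gen k A Unit (Gen.var v) * y) = gen k A Unit (Gen.var v) * iForms k A y :=
  superDer_var_mul ..

theorem dForms_t_mul (y : Forms k A Unit) :
    dForms k A Unit (tVar k A * y) = tVar k A * dForms k A Unit y :=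
  superDer_var_mul ..

theorem iForms_one : iForms k A 1 = 0 := superDer_one ..

/-- `d² = 0`. -/
theorem dForms_dForms (x : Forms k A X) : dForms k A X (dForms k A X x) = 0 := by
  refine (Submodule.mem_bot k).1
    (linearMap_induction ((dForms k A X).comp (dForms k A X)) ⊥ (fun l => ?_) x)
  rw [Submodule.mem_bot, LinearMap.comp_apply]
  induction l with
  | nil => simp [word, dForms_one]
  | cons g l ih =>
    rw [word_cons]
    cases g <;> simp [dForms_of_mul, dForms_diff_mul, dForms_var_mul, ih]

/-- `i_t² = 0`. -/
theorem iForms_iForms (x : Forms k A Unit) : iForms k A (iForms k A x) = 0 := by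
  refine (Submodule.mem_bot k).1
    (linearMap_induction ((iForms k A).comp (iForms k A)) ⊥ (fun l => ?_) x)
  rw [Submodule.mem_bot, LinearMap.comp_apply]
  induction l with
  | nil => simp [word, iForms_one]
  | cons g l ih =>
    rw [word_cons]
    cases g <;> simp [iForms_of_mul, iForms_diff_mul, iForms_var_mul, iForms_t_mul, ih,
      sub_mul, mul_assoc]

/-- Cartan formula: `d i_t + i_t d` is the commutator with `t`. -/
theorem cartan (x : Forms k A Unit) :
    dForms k A Unit (iForms k A x) + iForms k A (dForms k A Unit x) =
      x * tVar k A - tVar k A * x := by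
  have := linearMap_induction ((dForms k A Unit).comp (iForms k A)
    + (iForms k A).comp (dForms k A Unit)
    - (LinearMap.mulRight k (tVar k A) - LinearMap.mulLeft k (tVar k A))) ⊥ (fun l => ?_) x
  · simpa [sub_eq_zero] using this
  rw [Submodule.mem_bot]
  simp only [LinearMap.sub_apply, LinearMap.add_apply, LinearMap.comp_apply,
    LinearMap.mulRight_apply, LinearMap.mulLeft_apply]
  rw [sub_eq_zero]
  induction l with
  | nil => simp [word, dForms_one, iForms_one]
  | cons g l ih =>
    rw [word_cons]
    have ih' := eq_sub_of_add_eq ih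
    cases g with
    | of a =>
      simp only [dForms_of_mul, iForms_of_mul, iForms_diff_mul, map_add, ih', sub_mul, mul_sub,
        mul_assoc]
      abel
    | diff a =>
      simp only [dForms_of_mul, dForms_diff_mul, dForms_t_mul, iForms_diff_mul, map_sub, map_neg,
        ih', sub_mul, mul_sub, mul_add, mul_assoc]
      abel
    | var v =>
      have hv : gen k A Unit (Gen.var v) = tVar k A := rfl
      simp only [hv, dForms_t_mul, iForms_t_mul, ih', mul_sub, mul_assoc]
      abel

/-! ### The reduced de Rham complexes -/

variable (k A X)

/-- The reduced commutator quotient `Ω / ([Ω, Ω] + k⟨X⟩)`: for `X = ∅` it is the reduced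
noncommutative de Rham complex of `A`, and for `X = {t}` its reduced extended version. -/
abbrev DRbar : Type (max v w) := Forms k A X ⧸ (commutators k A X ⊔ scalars k A X)

/-- The reduced noncommutative de Rham complex of `A`. -/
abbrev DR0 : Type (max v w) := DRbar k A Empty

/-- The reduced extended noncommutative de Rham complex of `A`. -/
abbrev DRt : Type (max v w) := DRbar k A Unit

/-- The image in `DRbar` of the forms of de Rham degree `p` and degree `q` in the variables. -/
noncomputable def gr (p q : ℤ) : Submodule k (DRbar k A X) :=
  (bideg k A X p q).map (commutators k A X ⊔ scalars k A X).mkQ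

variable {k A X}

theorem sup_le_comap {Y : Type} (f : Forms k A X →ₗ[k] Forms k A Y)
    (h1 : ∀ x ∈ commutators k A X, f x ∈ commutators k A Y)
    (h2 : ∀ x ∈ scalars k A X, f x ∈ scalars k A Y) :
    commutators k A X ⊔ scalars k A X ≤ (commutators k A Y ⊔ scalars k A Y).comap f :=
  sup_le (fun x hx => Submodule.mem_sup_left (h1 x hx))
    (fun x hx => Submodule.mem_sup_right (h2 x hx))

theorem dForms_mem_scalars {x : Forms k A X} (hx : x ∈ scalars k A X) :
    dForms k A X x ∈ scalars k A X := by
  have h : dForms k A X x = 0 := superDer_scalar _ _ _ _ _ _ hx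
  rw [h]
  exact zero_mem _

theorem iForms_mem_scalars {x : Forms k A Unit} (hx : x ∈ scalars k A Unit) :
    iForms k A x ∈ scalars k A Unit := by
  have h : iForms k A x = 0 := superDer_scalar _ _ _ _ _ _ hx
  rw [h]
  exact zero_mem _

variable (k A X)

/-- The Karoubi-de Rham differential `d` on the reduced commutator quotient. -/
noncomputable def dDR : DRbar k A X →ₗ[k] DRbar k A X :=
  Submodule.mapQ _ _ (dForms k A X)
    (sup_le_comap _ (fun _ => dForms_mem_commutators) (fun _ => dForms_mem_scalars))

/-- The contraction `i_t` on the reduced extended de Rham complex. -/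
noncomputable def iDR : DRt k A →ₗ[k] DRt k A :=
  Submodule.mapQ _ _ (iForms k A)
    (sup_le_comap _ (fun _ => iForms_mem_commutators) (fun _ => iForms_mem_scalars))

/-- The projection `Ω_t A → Ω A` modulo `t`. -/
noncomputable def modTForms : Forms k A Unit →ₐ[k] Forms k A Empty :=
  lift (ofHom k A Empty) (diffHom k A Empty) gen_diff_one gen_diff_mul (fun _ => 0)

/-- The inclusion `Ω A → Ω_t A`. -/
noncomputable def inclForms : Forms k A Empty →ₐ[k] Forms k A Unit :=
  lift (ofHom k A Unit) (diffHom k A Unit) gen_diff_one gen_diff_mul (fun v => v.elim)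

variable {k A X}

theorem modTForms_of (a : A) :
    modTForms k A (gen k A Unit (Gen.of a)) = gen k A Empty (Gen.of a) := lift_gen_of ..

theorem modTForms_diff (a : A) :
    modTForms k A (gen k A Unit (Gen.diff a)) = gen k A Empty (Gen.diff a) := lift_gen_diff ..

theorem modTForms_var (v : Unit) :
    modTForms k A (gen k A Unit (Gen.var v)) = 0 := lift_gen_var ..

theorem modTForms_t : modTForms k A (tVar k A) = 0 := lift_gen_var ..

theorem inclForms_of (a : A) :
    inclForms k A (gen k A Empty (Gen.of a)) = gen k A Unit (Gen.of a) := lift_gen_of ..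

theorem inclForms_diff (a : A) :
    inclForms k A (gen k A Empty (Gen.diff a)) = gen k A Unit (Gen.diff a) := lift_gen_diff ..

theorem algHom_mem_bideg {Y : Type} (f : Forms k A X →ₐ[k] Forms k A Y)
    (h : ∀ g, f (gen k A X g) ∈ bideg k A Y g.deg g.wt) {p q : ℤ} {x : Forms k A X}
    (hx : x ∈ bideg k A X p q) : f x ∈ bideg k A Y p q := by
  refine map_bideg f.toLinearMap _ ?_ hx
  rintro l rfl rfl
  clear hx
  rw [AlgHom.toLinearMap_apply]
  induction l with
  | nil => simpa [word] using word_mem_bideg (k := k) ([] : List (Gen A Y))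
  | cons g l ih =>
    rw [word_cons, map_mul]
    simpa using mul_mem_bideg (h g) ih

theorem algHom_mem_commutators {Y : Type} (f : Forms k A X →ₐ[k] Forms k A Y)
    (h : ∀ g, f (gen k A X g) ∈ bideg k A Y g.deg g.wt) {x : Forms k A X}
    (hx : x ∈ commutators k A X) : f x ∈ commutators k A Y := by
  have hdeg : ∀ {p : ℤ} {x : Forms k A X}, x ∈ deg k A X p → f x ∈ deg k A Y p := by
    intro p x hx
    refine map_deg f.toLinearMap _ ?_ hx
    rintro l rfl
    exact bideg_le_deg _ _ (algHom_mem_bideg f h (word_mem_bideg l))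
  have : commutators k A X ≤ (commutators k A Y).comap f.toLinearMap := by
    refine Submodule.span_le.2 ?_
    rintro _ ⟨p, r, a, ha, b, hb, rfl⟩
    refine Submodule.subset_span ⟨p, r, f a, hdeg ha, f b, hdeg hb, ?_⟩
    simp [Units.smul_def]
  exact this hx

theorem modTForms_gen (g : Gen A Unit) :
    modTForms k A (gen k A Unit g) ∈ bideg k A Empty g.deg g.wt := by
  cases g with
  | of a => rw [modTForms_of]; exact gen_mem_bideg (Gen.of a)
  | diff a => rw [modTForms_diff]; exact gen_mem_bideg (Gen.diff a)
  | var v => rw [modTForms_var]; exact zero_mem _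

theorem inclForms_gen (g : Gen A Empty) :
    inclForms k A (gen k A Empty g) ∈ bideg k A Unit g.deg g.wt := by
  cases g with
  | of a => rw [inclForms_of]; exact gen_mem_bideg (Gen.of a)
  | diff a => rw [inclForms_diff]; exact gen_mem_bideg (Gen.diff a)
  | var v => exact v.elim

theorem modTForms_mem_scalars {x : Forms k A Unit} (hx : x ∈ scalars k A Unit) :
    modTForms k A x ∈ scalars k A Empty := by
  have : Algebra.adjoin k (Set.range fun v : Unit => gen k A Unit (Gen.var v)) ≤
      (Algebra.adjoin k (Set.range fun v : Empty => gen k A Empty (Gen.var v))).comap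
        (modTForms k A) := by
    refine Algebra.adjoin_le ?_
    rintro _ ⟨v, rfl⟩
    change modTForms k A (gen k A Unit (Gen.var v)) ∈ Algebra.adjoin k _
    rw [modTForms_var]
    exact zero_mem _
  exact this hx

theorem inclForms_mem_scalars {x : Forms k A Empty} (hx : x ∈ scalars k A Empty) :
    inclForms k A x ∈ scalars k A Unit := by
  have : Algebra.adjoin k (Set.range fun v : Empty => gen k A Empty (Gen.var v)) ≤
      (Algebra.adjoin k (Set.range fun v : Unit => gen k A Unit (Gen.var v))).comap
        (inclForms k A) := by
    refine Algebra.adjoin_le ?_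
    rintro _ ⟨v, rfl⟩
    exact v.elim
  exact this hx

theorem modTForms_dForms (x : Forms k A Unit) :
    modTForms k A (dForms k A Unit x) = dForms k A Empty (modTForms k A x) := by
  have := linearMap_induction ((modTForms k A).toLinearMap.comp (dForms k A Unit)
    - (dForms k A Empty).comp (modTForms k A).toLinearMap) ⊥ (fun l => ?_) x
  · simpa [sub_eq_zero] using this
  rw [Submodule.mem_bot, LinearMap.sub_apply, sub_eq_zero]
  simp only [LinearMap.comp_apply, AlgHom.toLinearMap_apply]
  induction l with
  | nil => simp [word, dForms_one]
  | cons g l ih =>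
    rw [word_cons]
    cases g <;> simp [dForms_of_mul, dForms_diff_mul, dForms_var_mul, modTForms_of,
      modTForms_diff, modTForms_var, ih]

theorem modTForms_iForms (x : Forms k A Unit) : modTForms k A (iForms k A x) = 0 := by
  have := linearMap_induction ((modTForms k A).toLinearMap.comp (iForms k A)) ⊥
    (fun l => ?_) x
  · simpa using this
  rw [Submodule.mem_bot]
  simp only [LinearMap.comp_apply, AlgHom.toLinearMap_apply]
  induction l with
  | nil => simp [word, iForms_one]
  | cons g l ih =>
    rw [word_cons]
    cases g <;> simp [iForms_of_mul, iForms_diff_mul, iForms_var_mul, modTForms_of,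
      modTForms_diff, modTForms_var, modTForms_t, ih]

variable (k A)

/-- The projection modulo `t` of the reduced extended de Rham complex onto
the reduced de Rham complex. -/
noncomputable def modT : DRt k A →ₗ[k] DR0 k A :=
  Submodule.mapQ _ _ (modTForms k A).toLinearMap
    (sup_le_comap _ (fun _ => algHom_mem_commutators _ modTForms_gen)
      (fun _ => modTForms_mem_scalars))

/-- The inclusion of the reduced de Rham complex into the reduced extended
de Rham complex, as the part of degree `0` in `t`. -/
noncomputable def incl : DR0 k A →ₗ[k] DRt k A :=
  Submodule.mapQ _ _ (inclForms k A).toLinearMap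
    (sup_le_comap _ (fun _ => algHom_mem_commutators _ inclForms_gen)
      (fun _ => inclForms_mem_scalars))

variable {k A}

theorem dDR_dDR (x : DRbar k A X) : dDR k A X (dDR k A X x) = 0 := by
  obtain ⟨x, rfl⟩ := Submodule.Quotient.mk_surjective _ x
  simp [dDR, dForms_dForms]

theorem iDR_iDR (x : DRt k A) : iDR k A (iDR k A x) = 0 := by
  obtain ⟨x, rfl⟩ := Submodule.Quotient.mk_surjective _ x
  simp [iDR, iForms_iForms]

/-- `d` and `i_t` anticommute on the extended de Rham complex. -/
theorem dDR_iDR (x : DRt k A) :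
    dDR k A Unit (iDR k A x) = -iDR k A (dDR k A Unit x) := by
  obtain ⟨x, rfl⟩ := Submodule.Quotient.mk_surjective _ x
  rw [eq_neg_iff_add_eq_zero]
  change Submodule.Quotient.mk (dForms k A Unit (iForms k A x) +
    iForms k A (dForms k A Unit x)) = _
  rw [Submodule.Quotient.mk_eq_zero, cartan]
  refine Submodule.mem_sup_left ?_
  refine linearMap_induction
    (LinearMap.mulRight k (tVar k A) - LinearMap.mulLeft k (tVar k A)) _ (fun l => ?_) x
  refine Submodule.subset_span ⟨_, 0, _, word_mem_deg l, tVar k A,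
    bideg_le_deg _ _ (gen_mem_bideg (Gen.var ())), ?_⟩
  simp

theorem modT_dDR (x : DRt k A) : modT k A (dDR k A Unit x) = dDR k A Empty (modT k A x) := by
  obtain ⟨x, rfl⟩ := Submodule.Quotient.mk_surjective _ x
  simp [modT, dDR, modTForms_dForms]

theorem modT_iDR (x : DRt k A) : modT k A (iDR k A x) = 0 := by
  obtain ⟨x, rfl⟩ := Submodule.Quotient.mk_surjective _ x
  simp [modT, iDR, modTForms_iForms]

theorem dDR_mem_gr {p q : ℤ} {x : DRbar k A X} (hx : x ∈ gr k A X p q) :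
    dDR k A X x ∈ gr k A X (p + 1) q := by
  obtain ⟨y, hy, rfl⟩ := hx
  exact ⟨_, dForms_mem_bideg hy, rfl⟩

theorem iDR_mem_gr {p q : ℤ} {x : DRt k A} (hx : x ∈ gr k A Unit p q) :
    iDR k A x ∈ gr k A Unit (p - 1) (q + 1) := by
  obtain ⟨y, hy, rfl⟩ := hx
  exact ⟨_, iForms_mem_bideg hy, rfl⟩

theorem modT_mem_gr {p q : ℤ} {x : DRt k A} (hx : x ∈ gr k A Unit p q) :
    modT k A x ∈ gr k A Empty p q := by
  obtain ⟨y, hy, rfl⟩ := hx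
  exact ⟨_, algHom_mem_bideg _ modTForms_gen hy, rfl⟩

theorem gr_of_neg {p q : ℤ} (hq : q < 0) : gr k A X p q = ⊥ := by
  have hwt : ∀ l : List (Gen A X), 0 ≤ (l.map Gen.wt).sum := by
    intro l
    refine List.sum_nonneg ?_
    intro n hn
    obtain ⟨g, _, rfl⟩ := List.mem_map.1 hn
    cases g <;> simp [Gen.wt]
  have : bideg k A X p q = ⊥ := by
    refine Submodule.span_eq_bot.2 ?_
    rintro _ ⟨l, _, h2, _⟩
    have := hwt l
    omega
  rw [gr, this, Submodule.map_bot]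

/-! ### Homology -/

section Homology

variable {M N : Type*} [AddCommGroup M] [Module k M] [AddCommGroup N] [Module k N]

/-- The homology `(ker D ∩ Z) / D(B)` of a differential `D`, where `Z` is the homogeneous
component in question and `B` is the component that `D` maps into `Z`. -/
abbrev Homology (D : M →ₗ[k] M) (Z B : Submodule k M) :=
  ↥(LinearMap.ker D ⊓ Z) ⧸ (B.map D).submoduleOf (LinearMap.ker D ⊓ Z)

/-- The homology class of a cycle. -/
noncomputable def Homology.cls {D : M →ₗ[k] M} {Z : Submodule k M} (B : Submodule k M)
    (z : M) (hz : z ∈ LinearMap.ker D ⊓ Z) : Homology D Z B :=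
  Submodule.Quotient.mk ⟨z, hz⟩

/-- The map on homology induced by a linear map that respects cycles and boundaries. -/
noncomputable def Homology.map {D : M →ₗ[k] M} {Z B : Submodule k M}
    {D' : N →ₗ[k] N} {Z' B' : Submodule k N} (f : M →ₗ[k] N)
    (hZ : ∀ z ∈ LinearMap.ker D ⊓ Z, f z ∈ LinearMap.ker D' ⊓ Z')
    (hB : ∀ y ∈ B, f (D y) ∈ B'.map D') :
    Homology D Z B →ₗ[k] Homology D' Z' B' :=
  Submodule.mapQ _ _ (f.restrict hZ) (by
    rintro ⟨z, hz⟩ ⟨y, hy, hyz⟩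
    change D y = z at hyz
    subst hyz
    exact hB y hy)

end Homology

variable (k A)

/-- The differential `i_t` on `DRt / d DRt`. -/
noncomputable def iQuot : (DRt k A ⧸ LinearMap.range (dDR k A Unit)) →ₗ[k]
    (DRt k A ⧸ LinearMap.range (dDR k A Unit)) :=
  Submodule.mapQ _ _ (iDR k A) (by
    rintro _ ⟨x, rfl⟩
    refine ⟨-iDR k A x, ?_⟩
    rw [map_neg, dDR_iDR, neg_neg])

/-- The bigraded components of `DRt / d DRt`. -/
noncomputable def grQuot (p q : ℤ) : Submodule k (DRt k A ⧸ LinearMap.range (dDR k A Unit)) :=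
  (gr k A Unit p q).map (LinearMap.range (dDR k A Unit)).mkQ

/-- The reduced Karoubi-de Rham homology `HD_n(A)`. -/
abbrev HD (n : ℤ) := Homology (dDR k A Empty) (gr k A Empty n 0) (gr k A Empty (n - 1) 0)

/-- The component of de Rham degree `p` and degree `q` in `t` of `H(DRt / d DRt, i_t)`. -/
abbrev HQuot (p q : ℤ) := Homology (iQuot k A) (grQuot k A p q) (grQuot k A (p + 1) (q - 1))

/-- The `k[u]`-module `DRt ⊗ R` with `R = k((u)) / u k[[u]]`. As `R` is free over `k` on the
powers `u ^ (-j)`, `j ≥ 0`, its elements are the finite sums `∑ f_j u ^ (-j)` and are encoded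
by their coefficients `j ↦ f_j`. -/
abbrev DRtR := ℕ →₀ DRt k A

/-- Multiplication by `u` on `DRt ⊗ R`; it kills the coefficient of `u ^ 0`. -/
noncomputable def mulU : DRtR k A →ₗ[k] DRtR k A :=
  Finsupp.lcomapDomain Nat.succ Nat.succ_injective

/-- Multiplication by `u ^ (-m)` on `DRt ⊗ R`. -/
noncomputable def mulUInv (m : ℕ) : DRtR k A →ₗ[k] DRtR k A :=
  Finsupp.lmapDomain (DRt k A) k (fun j => j + m)

/-- The differential `i_t - u d` on `DRt ⊗ R`. -/
noncomputable def diffU : DRtR k A →ₗ[k] DRtR k A :=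
  Finsupp.mapRange.linearMap (iDR k A) - (mulU k A).comp (Finsupp.mapRange.linearMap (dDR k A Unit))

/-- The component of homological degree `l` and internal degree `n` of `DRt ⊗ R`, where
`u ^ (-j)` times a form of bidegree `(p, q)` has homological degree `p + 2 j` and
internal degree `p + q + j`. -/
def comp (l n : ℤ) : Submodule k (DRtR k A) where
  carrier := {f | ∀ j : ℕ, f j ∈ gr k A Unit (l - 2 * j) (n - l + j)}
  add_mem' := fun hf hg j => Submodule.add_mem _ (hf j) (hg j)
  zero_mem' := fun _ => Submodule.zero_mem _
  smul_mem' := fun r _ hf j => Submodule.smul_mem _ r (hf j)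

/-- The (total) reduced extended cyclic homology `EHC(A) = H(DRt ⊗ R, i_t - u d)`. -/
abbrev EHC := Homology (diffU k A) ⊤ ⊤

/-- The weight component `EHC_l(A, m)`: the homology in homological degree `l` of the subcomplex
of internal degree `l - m`. -/
abbrev EHCw (l m : ℤ) :=
  Homology (diffU k A) (comp k A l (l - m)) (comp k A (l + 1) (l - m))

/-- The natural map `EHC_l(A, m) → EHC(A)`. -/
noncomputable def toEHC (l m : ℤ) : EHCw k A l m →ₗ[k] EHC k A :=
  Homology.map LinearMap.id (fun _ hz => ⟨hz.1, trivial⟩) (fun y _ => ⟨y, trivial, rfl⟩)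

variable {k A}

theorem mulU_apply (f : DRtR k A) (j : ℕ) : mulU k A f j = f (j + 1) := rfl

theorem mulUInv_apply_add (m : ℕ) (f : DRtR k A) (j : ℕ) : mulUInv k A m f (j + m) = f j :=
  Finsupp.mapDomain_apply (add_left_injective m) f j

theorem mulUInv_apply_of_lt (m : ℕ) (f : DRtR k A) (j : ℕ) (hj : j < m) :
    mulUInv k A m f j = 0 := by
  refine Finsupp.mapDomain_of_notMem_range f j ?_
  rintro ⟨i, hi⟩
  have hi' : i + m = j := hi
  omega

theorem diffU_apply (f : DRtR k A) (j : ℕ) :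
    diffU k A f j = iDR k A (f j) - dDR k A Unit (f (j + 1)) := by
  simp [diffU, mulU_apply]

/-- `(i_t - u d)² = 0`. -/
theorem diffU_diffU (f : DRtR k A) : diffU k A (diffU k A f) = 0 := by
  ext j
  simp [diffU_apply, iDR_iDR, dDR_dDR, dDR_iDR]

/-- `i_t - u d` has homological degree `-1` and internal degree `0`. -/
theorem diffU_mem_comp {l n : ℤ} {f : DRtR k A} (hf : f ∈ comp k A l n) :
    diffU k A f ∈ comp k A (l - 1) n := by
  intro j
  rw [diffU_apply]
  refine Submodule.sub_mem _ ?_ ?_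
  · have := iDR_mem_gr (hf j)
    convert this using 1
    congr 1 <;> ring
  · have := dDR_mem_gr (hf (j + 1))
    convert this using 1
    push_cast
    congr 1 <;> ring

variable (k A)

/-- The map `π_m : EHC_l(A, m) → HD_{l - 2 m}(A)`, `∑ f_j u ^ (-j) ↦ f_m mod t`, for `m > 0`. -/
noncomputable def piPos (l : ℤ) (m : ℕ) (hm : 0 < m) :
    EHCw k A l m →ₗ[k] HD k A (l - 2 * m) :=
  Homology.map ((modT k A).comp (Finsupp.lapply m))
    (by
      rintro z ⟨hz, hc⟩
      refine ⟨?_, ?_⟩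
      · obtain ⟨j, rfl⟩ : ∃ j, m = j + 1 := ⟨m - 1, by omega⟩
        have h : diffU k A z j = 0 := by rw [LinearMap.mem_ker.1 hz]; rfl
        rw [diffU_apply, sub_eq_zero] at h
        simp [← modT_dDR, ← h, modT_iDR]
      · have h := modT_mem_gr (hc m)
        rw [show l - (m : ℤ) - l + m = 0 by ring] at h
        exact h)
    (by
      intro y hy
      have h := modT_mem_gr (hy (m + 1))
      rw [show l - (m : ℤ) - (l + 1) + ((m + 1 : ℕ) : ℤ) = 0 by push_cast; ring,
        show l + 1 - 2 * ((m + 1 : ℕ) : ℤ) = l - 2 * m - 1 by push_cast; ring] at h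
      refine ⟨-modT k A (y (m + 1)), Submodule.neg_mem _ h, ?_⟩
      simp [diffU_apply, modT_iDR, modT_dDR])

/-- The map `π_- : EHC_l(A, m) → H(DRt / d DRt, i_t)^{l, -m}`,
`∑ f_j u ^ (-j) ↦ f_0 mod im d` (used for `m ≤ 0`). -/
noncomputable def piNeg (l m : ℤ) : EHCw k A l m →ₗ[k] HQuot k A l (-m) :=
  Homology.map ((LinearMap.range (dDR k A Unit)).mkQ.comp (Finsupp.lapply 0))
    (by
      rintro z ⟨hz, hc⟩
      refine ⟨?_, ?_⟩
      · have h : diffU k A z 0 = 0 := by rw [LinearMap.mem_ker.1 hz]; rfl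
        rw [diffU_apply, sub_eq_zero] at h
        simp [iQuot, h]
      · have h := hc 0
        rw [show l - 2 * ((0 : ℕ) : ℤ) = l by simp,
          show l - m - l + ((0 : ℕ) : ℤ) = -m by simp] at h
        exact ⟨_, h, rfl⟩)
    (by
      intro y hy
      have h := hy 0
      rw [show l + 1 - 2 * ((0 : ℕ) : ℤ) = l + 1 by simp,
        show l - m - (l + 1) + ((0 : ℕ) : ℤ) = -m - 1 by push_cast; ring] at h
      refine ⟨_, ⟨_, h, rfl⟩, ?_⟩
      have h0 : (LinearMap.range (dDR k A Unit)).mkQ (dDR k A Unit (y (0 + 1))) = 0 :=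
        (Submodule.Quotient.mk_eq_zero _).2 ⟨_, rfl⟩
      rw [LinearMap.comp_apply, Finsupp.lapply_apply, diffU_apply, map_sub, h0, sub_zero]
      rfl)

/-! ### Sections of `d` and the operator `(Id - u⁻¹ s i_t)⁻¹` -/

/-- The part `DRt⁺` of positive degree in `t`. -/
noncomputable def plus : Submodule k (DRt k A) :=
  ⨆ (p : ℤ) (q : ℤ) (_ : 0 < q), gr k A Unit p q

/-- The part of `DRt` of de Rham degree at most `p`. -/
noncomputable def degLE (p : ℤ) : Submodule k (DRt k A) :=
  ⨆ (i : ℤ) (_ : i ≤ p) (q : ℤ), gr k A Unit i q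

variable {k A}

/-- `s` restricts to a set-theoretic section `d DRt⁺ → DRt⁺` of the surjection
`d : DRt⁺ → d DRt⁺`. The values of `s` outside `d DRt⁺` are irrelevant. -/
structure IsSection (s : DRt k A → DRt k A) : Prop where
  mem : ∀ y ∈ (plus k A).map (dDR k A Unit), s y ∈ plus k A
  d_apply : ∀ y ∈ (plus k A).map (dDR k A Unit), dDR k A Unit (s y) = y

/-- On `d DRt⁺` the map `s` lowers the de Rham degree by at least one. -/
def LowersDegree (s : DRt k A → DRt k A) : Prop :=
  ∀ p : ℤ, ∀ y ∈ (plus k A).map (dDR k A Unit), y ∈ degLE k A (p + 1) → s y ∈ degLE k A p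

/-- `z = (Id - u⁻¹ s i_t)⁻¹ x`, that is, `z - u⁻¹ s i_t z = x`, where `s` is applied to
each coefficient in `u`; equivalently `z = ∑ u ^ (-j) (s i_t)^j x`. -/
structure IsInverseImage (s : DRt k A → DRt k A) (x : DRt k A) (z : DRtR k A) : Prop where
  zero : z 0 = x
  succ : ∀ j : ℕ, z (j + 1) - s (iDR k A (z j)) = 0

end Algebra

end NCForms

/-! The theorem rests on one fact: the part of `DRt` of positive degree in `t` is acyclic for `d`
(`exists_dDR_eq`). Its proof combines two tools.

The first is the cyclic derivative `D` in `t` (`cyclicDeriv`), which sends a word to the sum of `± v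
u` over its factorizations `u t v`. It kills supercommutators (`cyclicDeriv_commutator`), commutes
with `d` (`cyclicDeriv_dForms`), and satisfies an Euler identity: `D(x) t` is congruent to `q x`
modulo supercommutators and `k[t]` if `x` has degree `q` in `t` (`mk_cyclic_mul_t`). So `D` replaces
a closed class by an actual form in `Ω_t` whose differential lies in `k[t]`.

The second is a contraction `K` of `Ω_t` itself onto `k[t]` (`homotopy`). Every form is a sum of
terms `a w` with `w` a product of factors `db` and `t b`. For a splitting `ρ` of `k → A`, put `K(1)
= 0`, `K(a w) = ρ(a) K(w)`, `K(da w) = a w - ρ(a) w` and `K(t a w) = ρ(a) t K(w)`. Then `dK + Kd -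
1` takes values in `k[t]` (`homotopyDefect_mem`). For `z = K(D x)` this gives `d(z t) ≡ q x`, and
`q` is invertible because `k` contains the rationals.

Now `∑ f_j u^(-j)` is a cycle of `i_t - u d` exactly when `d f_{j+1} = i_t f_j` for all `j ≥ 0`;
nothing is imposed on `d f_0`. In internal degree `l - m` the coefficient `f_j` has degree `j - m`
in `t`. For `m > 0` the coefficients below `f_m` therefore vanish, and `f_m` is a closed form
without `t`; for `m ≤ 0` the first coefficient `f_0` is only required to have `i_t f_0` exact. All
later coefficients lie in the acyclic part. They can be found recursively, and the recursion stops
because the de Rham degree drops by two each time (`exists_primitive`). The same recursion, applied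
to a cycle with trivial leading term, produces a primitive, which gives injectivity.

A set-theoretic section of `d` makes the recursion explicit but need not respect the grading. The
resulting cycle still differs from a homogeneous one by a cycle whose leading coefficient is exact
and whose other coefficients have positive degree in `t`. Such a cycle is a boundary, component by
component (`exists_diffU_eq`). -/

namespace NCForms

universe v w

/-! ### The bigrading of forms and of their reduced commutator quotients. -/

section Grading

variable {k : Type v} [CommRing k] {A : Type w} [Ring A] [Algebra k A] {X : Type}

variable (k A X) in
/-- Multiplication by `c` on families of forms, shifting the bidegree by `(e, f)`. -/
noncomputable def shiftMul (c : Forms k A X) (e f : ℤ) :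
    Module.End k (ℤ → ℤ → Forms k A X) where
  toFun φ := fun p q => c * φ (p - e) (q - f)
  map_add' φ ψ := by ext p q; simp [mul_add]
  map_smul' r φ := by ext p q; simp

theorem shiftMul_apply (c : Forms k A X) (e f : ℤ) (φ : ℤ → ℤ → Forms k A X) (p q : ℤ) :
    shiftMul k A X c e f φ p q = c * φ (p - e) (q - f) := rfl

variable (k A X) in
/-- The action of forms on families of forms that keeps track of the bidegree. -/
noncomputable def gradedAction : Forms k A X →ₐ[k] Module.End k (ℤ → ℤ → Forms k A X) :=
  lift
    (AlgHom.ofLinearMap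
      { toFun := fun a => shiftMul k A X (gen k A X (Gen.of a)) 0 0
        map_add' := fun a b => by
          ext φ p q; simp [shiftMul_apply, gen_of_add, add_mul]
        map_smul' := fun r a => by
          ext φ p q; simp [shiftMul_apply, gen_of_smul] }
      (by ext φ p q; simp [shiftMul_apply, gen_of_one])
      (fun a b => by ext φ p q; simp [shiftMul_apply, gen_of_mul, mul_assoc]))
    { toFun := fun a => shiftMul k A X (gen k A X (Gen.diff a)) 1 0
      map_add' := fun a b => by
        ext φ p q; simp [shiftMul_apply, gen_diff_add, add_mul]
      map_smul' := fun r a => by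
        ext φ p q; simp [shiftMul_apply, gen_diff_smul] }
    (by ext φ p q; simp [shiftMul_apply, gen_diff_one])
    (fun a b => by
      ext φ p q; simp [shiftMul_apply, gen_diff_mul, add_mul, mul_assoc])
    (fun x => shiftMul k A X (gen k A X (Gen.var x)) 0 1)

theorem gradedAction_gen (g : Gen A X) :
    gradedAction k A X (gen k A X g) = shiftMul k A X (gen k A X g) g.deg g.wt := by
  cases g
  · exact lift_gen_of ..
  · exact lift_gen_diff ..
  · exact lift_gen_var ..

variable (k A X) in
/-- The projection of forms to the component of bidegree `(p, q)`. -/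
noncomputable def projForms (p q : ℤ) : Forms k A X →ₗ[k] Forms k A X :=
  (LinearMap.proj q).comp ((LinearMap.proj p).comp
    ((LinearMap.applyₗ (Pi.single 0 (Pi.single 0 1))).comp (gradedAction k A X).toLinearMap))

theorem projForms_apply (p q : ℤ) (x : Forms k A X) :
    projForms k A X p q x = gradedAction k A X x (Pi.single 0 (Pi.single 0 1)) p q := rfl

/-- Each generator acts by multiplication combined with a shift by its bidegree. A word applied to
the family concentrated at `(0, 0)` thus ends up concentrated at the bidegree of the word. This is
what shows that the spans `bideg` are independent, although forms are given by generators and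
relations. -/
theorem projForms_word (p q : ℤ) (l : List (Gen A X)) :
    projForms k A X p q (word k A X l) =
      if (l.map Gen.deg).sum = p ∧ (l.map Gen.wt).sum = q then word k A X l else 0 := by
  rw [projForms_apply]
  induction l generalizing p q with
  | nil =>
    by_cases hp : (0 : ℤ) = p
    · subst hp
      by_cases hq : (0 : ℤ) = q
      · subst hq; simp [word]
      · simp [word, hq, Ne.symm hq]
    · simp [word, hp, Ne.symm hp]
  | cons g l ih =>
    rw [word_cons, map_mul, Module.End.mul_apply, gradedAction_gen, shiftMul_apply, ih]
    simp only [List.map_cons, List.sum_cons]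
    rw [mul_ite, mul_zero]
    refine if_congr ?_ rfl rfl
    constructor <;> rintro ⟨h1, h2⟩ <;> constructor <;> omega

theorem projForms_of_mem {p q : ℤ} {x : Forms k A X} (hx : x ∈ bideg k A X p q) :
    projForms k A X p q x = x := by
  have := map_bideg (projForms k A X p q - LinearMap.id) ⊥ (fun l h1 h2 => ?_) hx
  · simpa [sub_eq_zero] using this
  · simp [projForms_word, h1, h2]

theorem projForms_of_mem_of_ne {p q p' q' : ℤ} (h : ¬(p' = p ∧ q' = q)) {x : Forms k A X}
    (hx : x ∈ bideg k A X p' q') : projForms k A X p q x = 0 := by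
  have := map_bideg (projForms k A X p q) ⊥ (fun l h1 h2 => ?_) hx
  · simpa using this
  · simp [projForms_word, h1, h2, h]

theorem projForms_mem (p q : ℤ) (x : Forms k A X) :
    projForms k A X p q x ∈ bideg k A X p q := by
  refine linearMap_induction (projForms k A X p q) _ (fun l => ?_) x
  rw [projForms_word]
  split_ifs with h
  · rw [← h.1, ← h.2]; exact word_mem_bideg l
  · exact zero_mem _

/-- Supercommutators of words span all supercommutators. -/
theorem commutators_le {N : Submodule k (Forms k A X)}
    (h : ∀ l l' : List (Gen A X), word k A X (l ++ l') -
      ((l.map Gen.deg).sum * (l'.map Gen.deg).sum).negOnePow • word k A X (l' ++ l) ∈ N) :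
    commutators k A X ≤ N := by
  refine Submodule.span_le.2 ?_
  rintro _ ⟨p, r, a, ha, b, hb, rfl⟩
  refine map_deg (LinearMap.mulRight k b -
    (((p * r).negOnePow : ℤˣ) : ℤ) • LinearMap.mulLeft k b) N ?_ ha
  rintro l rfl
  refine map_deg (LinearMap.mulLeft k (word k A X l) -
    ((((l.map Gen.deg).sum * r).negOnePow : ℤˣ) : ℤ) • LinearMap.mulRight k (word k A X l)) N
    ?_ hb
  rintro l' rfl
  have := h l l'
  rw [Units.smul_def, word_append, word_append] at this
  exact this

theorem word_comm_mem (l l' : List (Gen A X)) : word k A X (l ++ l') -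
      ((l.map Gen.deg).sum * (l'.map Gen.deg).sum).negOnePow • word k A X (l' ++ l) ∈
        commutators k A X :=
  Submodule.subset_span ⟨_, _, _, word_mem_deg l, _, word_mem_deg l', by rw [word_append, word_append]⟩

theorem projForms_mem_commutators (p q : ℤ) {x : Forms k A X} (hx : x ∈ commutators k A X) :
    projForms k A X p q x ∈ commutators k A X := by
  refine (commutators_le (N := (commutators k A X).comap (projForms k A X p q)) ?_) hx
  intro l l'
  have hc := word_comm_mem (k := k) l l'
  rw [Units.smul_def] at hc ⊢
  rw [Submodule.mem_comap, map_sub, map_zsmul, projForms_word, projForms_word]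
  simp only [List.map_append, List.sum_append]
  -- The two words of the commutator have the same bidegree, so the projection keeps both or kills
  -- both.
  rw [add_comm (l'.map Gen.deg).sum, add_comm (l'.map Gen.wt).sum]
  split_ifs
  · exact hc
  · simp

theorem scalars_eq_span : scalars k A X =
    Submodule.span k (Set.range fun l : List X => word k A X (l.map Gen.var)) := by
  rw [scalars, Algebra.adjoin_eq_span]
  congr 1
  ext x
  constructor
  · intro hx
    induction hx using Submonoid.closure_induction with
    | mem x hx =>
      obtain ⟨v, rfl⟩ := hx
      exact ⟨[v], by simp [word]⟩
    | one => exact ⟨[], by simp [word]⟩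
    | mul x y _ _ hx hy =>
      obtain ⟨l, rfl⟩ := hx
      obtain ⟨l', rfl⟩ := hy
      exact ⟨l ++ l', by simp [word_append]⟩
  · rintro ⟨l, rfl⟩
    refine Submonoid.list_prod_mem _ ?_
    intro y hy
    simp only [List.map_map, List.mem_map, Function.comp_apply] at hy
    obtain ⟨v, _, rfl⟩ := hy
    exact Submonoid.subset_closure ⟨v, rfl⟩

theorem projForms_mem_scalars (p q : ℤ) {x : Forms k A X} (hx : x ∈ scalars k A X) :
    projForms k A X p q x ∈ scalars k A X := by
  have : scalars k A X ≤ (scalars k A X).comap (projForms k A X p q) := by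
    conv_lhs => rw [scalars_eq_span]
    refine Submodule.span_le.2 ?_
    rintro _ ⟨l, rfl⟩
    change projForms k A X p q (word k A X (l.map Gen.var)) ∈ scalars k A X
    rw [projForms_word]
    split_ifs
    · rw [scalars_eq_span]; exact Submodule.subset_span ⟨l, rfl⟩
    · exact zero_mem _
  exact this hx

variable (k A X) in
/-- The projection of the reduced commutator quotient to its component of bidegree `(p, q)`. -/
noncomputable def proj (p q : ℤ) : DRbar k A X →ₗ[k] DRbar k A X :=
  Submodule.mapQ _ _ (projForms k A X p q)
    (sup_le_comap _ (fun _ => projForms_mem_commutators p q)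
      (fun _ => projForms_mem_scalars p q))

theorem proj_mem (p q : ℤ) (x : DRbar k A X) : proj k A X p q x ∈ gr k A X p q := by
  obtain ⟨x, rfl⟩ := Submodule.Quotient.mk_surjective _ x
  exact ⟨_, projForms_mem p q x, rfl⟩

theorem proj_of_mem {p q : ℤ} {x : DRbar k A X} (hx : x ∈ gr k A X p q) :
    proj k A X p q x = x := by
  obtain ⟨y, hy, rfl⟩ := hx
  exact congrArg _ (projForms_of_mem hy)

theorem proj_of_mem_of_ne {p q p' q' : ℤ} (h : ¬(p' = p ∧ q' = q)) {x : DRbar k A X}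
    (hx : x ∈ gr k A X p' q') : proj k A X p q x = 0 := by
  obtain ⟨y, hy, rfl⟩ := hx
  exact (congrArg (commutators k A X ⊔ scalars k A X).mkQ
    (projForms_of_mem_of_ne h hy)).trans (map_zero _)

theorem mem_of_gr (N : Submodule k (DRbar k A X)) (h : ∀ p q, gr k A X p q ≤ N)
    (x : DRbar k A X) : x ∈ N := by
  obtain ⟨x, rfl⟩ := Submodule.Quotient.mk_surjective _ x
  exact linearMap_induction (commutators k A X ⊔ scalars k A X).mkQ N
    (fun l => h _ _ ⟨_, word_mem_bideg l, rfl⟩) x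

/-- Linear maps agree if they agree on homogeneous elements. -/
theorem linearMap_ext_gr {M : Type*} [AddCommGroup M] [Module k M] {f g : DRbar k A X →ₗ[k] M}
    (h : ∀ p q, ∀ x ∈ gr k A X p q, f x = g x) (x : DRbar k A X) : f x = g x := by
  have := mem_of_gr (LinearMap.ker (f - g)) (fun p q y hy => by simp [h p q y hy]) x
  simpa [sub_eq_zero] using this

theorem proj_dDR (p q : ℤ) (x : DRbar k A X) :
    proj k A X (p + 1) q (dDR k A X x) = dDR k A X (proj k A X p q x) := by
  refine linearMap_ext_gr (f := (proj k A X (p + 1) q).comp (dDR k A X))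
    (g := (dDR k A X).comp (proj k A X p q)) (fun p' q' y hy => ?_) x
  simp only [LinearMap.comp_apply]
  by_cases h : p' = p ∧ q' = q
  · obtain ⟨rfl, rfl⟩ := h
    rw [proj_of_mem hy, proj_of_mem (dDR_mem_gr hy)]
  · rw [proj_of_mem_of_ne h hy, proj_of_mem_of_ne (by omega) (dDR_mem_gr hy), map_zero]

theorem proj_iDR (p q : ℤ) (x : DRt k A) :
    proj k A Unit (p - 1) (q + 1) (iDR k A x) = iDR k A (proj k A Unit p q x) := by
  refine linearMap_ext_gr (f := (proj k A Unit (p - 1) (q + 1)).comp (iDR k A))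
    (g := (iDR k A).comp (proj k A Unit p q)) (fun p' q' y hy => ?_) x
  simp only [LinearMap.comp_apply]
  by_cases h : p' = p ∧ q' = q
  · obtain ⟨rfl, rfl⟩ := h
    rw [proj_of_mem hy, proj_of_mem (iDR_mem_gr hy)]
  · rw [proj_of_mem_of_ne h hy, proj_of_mem_of_ne (by omega) (iDR_mem_gr hy), map_zero]

/-- Components of negative de Rham degree vanish. -/
theorem gr_of_neg_left {p q : ℤ} (hp : p < 0) : gr k A X p q = ⊥ := by
  have : bideg k A X p q = ⊥ := by
    refine Submodule.span_eq_bot.2 ?_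
    rintro _ ⟨l, h1, _, _⟩
    have : 0 ≤ (l.map Gen.deg).sum := by
      refine List.sum_nonneg ?_
      intro n hn
      obtain ⟨g, _, rfl⟩ := List.mem_map.1 hn
      cases g <;> simp [Gen.deg]
    omega
  rw [gr, this, Submodule.map_bot]

/-- Every element is the sum of finitely many of its homogeneous components. -/
theorem exists_sum_proj (x : DRbar k A X) : ∃ F : Finset (ℤ × ℤ), ∀ F', F ⊆ F' →
    ∑ i ∈ F', proj k A X i.1 i.2 x = x := by
  classical
  -- Asking for the identity on every larger finite set makes the condition stable under sums: take
  -- the union of the two sets.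
  refine mem_of_gr
    { carrier := {x | ∃ F : Finset (ℤ × ℤ), ∀ F', F ⊆ F' →
        ∑ i ∈ F', proj k A X i.1 i.2 x = x}
      add_mem' := ?_
      zero_mem' := ⟨∅, by simp⟩
      smul_mem' := ?_ } ?_ x
  · rintro x y ⟨F, hF⟩ ⟨G, hG⟩
    refine ⟨F ∪ G, fun F' h => ?_⟩
    simp only [map_add, Finset.sum_add_distrib]
    rw [hF F' (Finset.union_subset_left h), hG F' (Finset.union_subset_right h)]
  · rintro r x ⟨F, hF⟩
    refine ⟨F, fun F' h => ?_⟩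
    simp only [map_smul, ← Finset.smul_sum]
    rw [hF F' h]
  · intro p q x hx
    refine ⟨{(p, q)}, fun F' h => ?_⟩
    rw [Finset.sum_eq_single (p, q)]
    · exact proj_of_mem hx
    · rintro ⟨p', q'⟩ _ hne
      refine proj_of_mem_of_ne ?_ hx
      rintro ⟨rfl, rfl⟩
      exact hne rfl
    · intro hn
      exact absurd (h (Finset.mem_singleton_self _)) hn

theorem mem_of_proj_mem (N : Submodule k (DRbar k A X)) {x : DRbar k A X}
    (h : ∀ p q, proj k A X p q x ∈ N) : x ∈ N := by
  obtain ⟨F, hF⟩ := exists_sum_proj x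
  rw [← hF F subset_rfl]
  exact Submodule.sum_mem _ fun i _ => h _ _

theorem gr_le_plus {p q : ℤ} (hq : 0 < q) : gr k A Unit p q ≤ plus k A :=
  le_iSup_of_le p (le_iSup_of_le q (le_iSup_of_le hq le_rfl))

theorem proj_of_mem_plus {p q : ℤ} (hq : q ≤ 0) {x : DRt k A} (hx : x ∈ plus k A) :
    proj k A Unit p q x = 0 := by
  have : plus k A ≤ LinearMap.ker (proj k A Unit p q) :=
    iSup_le fun p' => iSup_le fun q' => iSup_le fun h y hy =>
      proj_of_mem_of_ne (by omega) hy
  exact this hx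

/-- Degrees in `t` are nonnegative and `i_t` raises them by one. -/
theorem iDR_mem_plus (x : DRt k A) : iDR k A x ∈ plus k A := by
  refine mem_of_gr ((plus k A).comap (iDR k A)) (fun p q y hy => ?_) x
  rcases lt_or_ge q 0 with h | h
  · rw [gr_of_neg h, Submodule.mem_bot] at hy
    rw [hy]; exact zero_mem _
  · exact gr_le_plus (by omega) (iDR_mem_gr hy)

/-! ### Forms of degree zero in `t` -/

theorem incl_mem_gr {p q : ℤ} {x : DR0 k A} (hx : x ∈ gr k A Empty p q) :
    incl k A x ∈ gr k A Unit p q := by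
  obtain ⟨y, hy, rfl⟩ := hx
  exact ⟨_, algHom_mem_bideg _ inclForms_gen hy, rfl⟩

theorem modT_incl (x : DR0 k A) : modT k A (incl k A x) = x := by
  obtain ⟨x, rfl⟩ := Submodule.Quotient.mk_surjective _ x
  refine congrArg (Submodule.Quotient.mk) (?_ : modTForms k A (inclForms k A x) = x)
  have := linearMap_induction (((modTForms k A).comp (inclForms k A)).toLinearMap
    - LinearMap.id) ⊥ (fun l => ?_) x
  · simpa [sub_eq_zero] using this
  rw [Submodule.mem_bot, LinearMap.sub_apply, sub_eq_zero]
  simp only [AlgHom.toLinearMap_apply, AlgHom.comp_apply, LinearMap.id_apply]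
  induction l with
  | nil => simp [word]
  | cons g l ih =>
    rw [word_cons]
    cases g with
    | of a => simp [inclForms_of, modTForms_of, ih]
    | diff a => simp [inclForms_diff, modTForms_diff, ih]
    | var v => exact v.elim

theorem incl_dDR (x : DR0 k A) : incl k A (dDR k A Empty x) = dDR k A Unit (incl k A x) := by
  obtain ⟨x, rfl⟩ := Submodule.Quotient.mk_surjective _ x
  refine congrArg (Submodule.Quotient.mk)
    (?_ : inclForms k A (dForms k A Empty x) = dForms k A Unit (inclForms k A x))
  have := linearMap_induction ((inclForms k A).toLinearMap.comp (dForms k A Empty)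
    - (dForms k A Unit).comp (inclForms k A).toLinearMap) ⊥ (fun l => ?_) x
  · simpa [sub_eq_zero] using this
  rw [Submodule.mem_bot, LinearMap.sub_apply, sub_eq_zero]
  simp only [LinearMap.comp_apply, AlgHom.toLinearMap_apply]
  induction l with
  | nil => simp [word, dForms_one]
  | cons g l ih =>
    rw [word_cons]
    cases g with
    | of a => simp [dForms_of_mul, inclForms_of, inclForms_diff, ih]
    | diff a => simp [dForms_diff_mul, inclForms_diff, ih]
    | var v => exact v.elim

theorem sum_wt_nonneg {A : Type w} {X : Type} (l : List (Gen A X)) : 0 ≤ (l.map Gen.wt).sum := by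
  refine List.sum_nonneg ?_
  intro n hn
  obtain ⟨g, _, rfl⟩ := List.mem_map.1 hn
  cases g <;> simp [Gen.wt]

/-- A word of degree `0` in `t` contains no letter `t`. Together with `modT_incl` this identifies
the reduced de Rham complex with the degree-zero part of the extended one. -/
theorem incl_modT {p : ℤ} {x : DRt k A} (hx : x ∈ gr k A Unit p 0) :
    incl k A (modT k A x) = x := by
  obtain ⟨x, hx, rfl⟩ := hx
  refine congrArg (Submodule.Quotient.mk) (?_ : inclForms k A (modTForms k A x) = x)
  have := map_bideg (((inclForms k A).comp (modTForms k A)).toLinearMap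
    - LinearMap.id) ⊥ (fun l hp hl => ?_) hx
  · simpa [sub_eq_zero] using this
  rw [Submodule.mem_bot, LinearMap.sub_apply, sub_eq_zero]
  simp only [AlgHom.toLinearMap_apply, AlgHom.comp_apply, LinearMap.id_apply]
  clear hx hp
  induction l with
  | nil => simp [word]
  | cons g l ih =>
    rw [List.map_cons, List.sum_cons] at hl
    rw [word_cons]
    cases g with
    | of a => simp [inclForms_of, modTForms_of, ih (by simpa [Gen.wt] using hl)]
    | diff a => simp [inclForms_diff, modTForms_diff, ih (by simpa [Gen.wt] using hl)]
    | var v =>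
      have := sum_wt_nonneg l
      simp only [Gen.wt] at hl
      omega

end Grading

/-! ### A contraction of `Ω_t` onto `k[t]` built from a splitting `ρ` of `k → A`. -/

section Homotopy

open TensorProduct

variable {k : Type v} [CommRing k] {A : Type w} [Ring A] [Algebra k A]

variable (k A) in
/-- Left multiplication on the first tensor factor. -/
noncomputable def leftMul (N : Type*) [AddCommGroup N] [Module k N] :
    A →ₐ[k] Module.End k (A ⊗[k] N) :=
  AlgHom.ofLinearMap
    { toFun := fun a => LinearMap.rTensor N (LinearMap.mulLeft k a)
      map_add' := fun a b => by ext; simp [add_mul, TensorProduct.add_tmul]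
      map_smul' := fun r a => by ext; simp [TensorProduct.smul_tmul'] }
    (by ext; simp) (fun a b => by ext; simp)

theorem leftMul_tmul {N : Type*} [AddCommGroup N] [Module k N] (a b : A) (n : N) :
    leftMul k A N a (b ⊗ₜ n) = (a * b) ⊗ₜ n := rfl

variable (k) in
/-- The commutator with an element of an algebra. -/
noncomputable def adMap (B : Type*) [Ring B] [Algebra k B] (e : B) : B →ₗ[k] B :=
  LinearMap.mulLeft k e - LinearMap.mulRight k e

theorem adMap_apply {B : Type*} [Ring B] [Algebra k B] (e x : B) :
    adMap k B e x = e * x - x * e := rfl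

theorem adMap_one {B : Type*} [Ring B] [Algebra k B] (e : B) : adMap k B e 1 = 0 := by
  simp [adMap_apply]

theorem adMap_mul {B : Type*} [Ring B] [Algebra k B] (e x y : B) :
    adMap k B e (x * y) = adMap k B e x * y + x * adMap k B e y := by
  simp only [adMap_apply]
  noncomm_ring

/-- The action of `Ω_t` on `A ⊗ N` determined by linear maps `δ τ : A ⊗ N → N`: here
`da` acts as the commutator of `a ⊗ n ↦ 1 ⊗ δ (a ⊗ n)` with `a`, and `t` acts as
`a ⊗ n ↦ 1 ⊗ τ (a ⊗ n)`. -/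
noncomputable def tensorAction {N : Type*} [AddCommGroup N] [Module k N]
    (δ τ : A ⊗[k] N →ₗ[k] N) : Forms k A Unit →ₐ[k] Module.End k (A ⊗[k] N) :=
  lift (leftMul k A N)
    -- A commutator is a derivation that kills `1`, so the relations for `da` hold whatever `δ` is.
    -- This reflects the rewriting `da · b = d(ab) - a · db`.
    (adMap k (Module.End k (A ⊗[k] N)) (TensorProduct.mk k A N 1 ∘ₗ δ) ∘ₗ
      (leftMul k A N).toLinearMap)
    (by simp [adMap_one])
    (fun a b => by simp [adMap_mul])
    (fun _ => TensorProduct.mk k A N 1 ∘ₗ τ)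

section

variable {N : Type*} [AddCommGroup N] [Module k N] (δ τ : A ⊗[k] N →ₗ[k] N)

theorem tensorAction_of (a : A) (z : A ⊗[k] N) :
    tensorAction δ τ (gen k A Unit (Gen.of a)) z = leftMul k A N a z :=
  congrArg (fun f : Module.End k (A ⊗[k] N) => f z) (lift_gen_of ..)

theorem tensorAction_diff (a : A) (z : A ⊗[k] N) :
    tensorAction δ τ (gen k A Unit (Gen.diff a)) z =
      1 ⊗ₜ δ (leftMul k A N a z) - a ⊗ₜ δ z :=
  (congrArg (fun f : Module.End k (A ⊗[k] N) => f z) (lift_gen_diff ..)).trans (by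
    simp [adMap_apply, leftMul_tmul])

theorem tensorAction_t (z : A ⊗[k] N) :
    tensorAction δ τ (tVar k A) z = 1 ⊗ₜ τ z :=
  congrArg (fun f : Module.End k (A ⊗[k] N) => f z) (lift_gen_var ..)

end

variable (ρ : A →ₗ[k] k)

/-- `a ⊗ (w, l) ↦ (da w, (a - ρ a) w)`. -/
noncomputable def stateDiff :
    A ⊗[k] (Forms k A Unit × Forms k A Unit) →ₗ[k] Forms k A Unit × Forms k A Unit :=
  TensorProduct.lift
    (LinearMap.mk₂ k (fun a n => (diffHom k A Unit a * n.1, ofHom k A Unit a * n.1 - ρ a • n.1))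
      (fun a b n => by ext <;> simp [add_mul, add_smul]; abel)
      (fun r a n => by ext <;> simp [mul_smul, smul_sub])
      (fun a m n => by ext <;> simp [mul_add]; abel)
      (fun r a n => by ext <;> simp [smul_sub, smul_comm r]))

/-- `a ⊗ (w, l) ↦ (t a w, ρ a • t l)`. -/
noncomputable def stateVar :
    A ⊗[k] (Forms k A Unit × Forms k A Unit) →ₗ[k] Forms k A Unit × Forms k A Unit :=
  TensorProduct.lift
    (LinearMap.mk₂ k (fun a n => (tVar k A * (ofHom k A Unit a * n.1), ρ a • (tVar k A * n.2)))
      (fun a b n => by ext <;> simp [add_mul, mul_add, add_smul])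
      (fun r a n => by ext <;> simp [mul_smul])
      (fun a m n => by ext <;> simp [mul_add])
      (fun r a n => by ext <;> simp [smul_comm r]))

/-- The state of a form: a normal form of it in `A ⊗ Ω_t`, together with the values of the
homotopy on the second factor. -/
noncomputable def state :
    Forms k A Unit →ₗ[k] A ⊗[k] (Forms k A Unit × Forms k A Unit) :=
  (LinearMap.applyₗ ((1 : A) ⊗ₜ[k] ((1 : Forms k A Unit), (0 : Forms k A Unit)))).comp
    (tensorAction (stateDiff ρ) (stateVar ρ)).toLinearMap

/-- The contracting homotopy of `Ω_t` onto `k[t]`. -/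
noncomputable def homotopy : Forms k A Unit →ₗ[k] Forms k A Unit :=
  (TensorProduct.lift (LinearMap.mk₂ k
    (fun (a : A) (n : Forms k A Unit × Forms k A Unit) => ρ a • n.2)
    (fun a b n => by simp [add_smul])
    (fun r a n => by simp [mul_smul])
    (fun a m n => by simp)
    (fun r a n => by simp [smul_comm r]))).comp (state ρ)

theorem state_mul (x y : Forms k A Unit) :
    state ρ (x * y) = tensorAction (stateDiff ρ) (stateVar ρ) x (state ρ y) := by
  simp [state]

theorem state_one : state ρ (1 : Forms k A Unit) = 1 ⊗ₜ (1, 0) := by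
  simp [state]

/-- The forms with normal form `1 ⊗ w`. -/
noncomputable def normal : Submodule k (Forms k A Unit) where
  carrier := {w | state ρ w = 1 ⊗ₜ (w, homotopy ρ w)}
  add_mem' := by
    intro x y hx hy
    simp only [Set.mem_ofPred_eq] at *
    rw [map_add, map_add, hx, hy, ← TensorProduct.tmul_add, Prod.mk_add_mk]
  zero_mem' := by simp [← Prod.zero_eq_mk]
  smul_mem' := by
    intro r x hx
    simp only [Set.mem_ofPred_eq] at *
    rw [map_smul, map_smul, hx, ← TensorProduct.tmul_smul, Prod.smul_mk]

theorem mem_normal {w : Forms k A Unit} :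
    w ∈ normal ρ ↔ state ρ w = 1 ⊗ₜ (w, homotopy ρ w) := Iff.rfl

theorem homotopy_of_state {x : Forms k A Unit} {a : A} {n : Forms k A Unit × Forms k A Unit}
    (h : state ρ x = a ⊗ₜ n) : homotopy ρ x = ρ a • n.2 := by
  rw [homotopy, LinearMap.comp_apply, h]
  rfl

variable {ρ}

theorem state_of_mul (a : A) {w : Forms k A Unit} (hw : w ∈ normal ρ) :
    state ρ (gen k A Unit (Gen.of a) * w) = a ⊗ₜ (w, homotopy ρ w) := by
  rw [state_mul, (mem_normal ρ).1 hw, tensorAction_of, leftMul_tmul, mul_one]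

theorem homotopy_of_mul (a : A) {w : Forms k A Unit} (hw : w ∈ normal ρ) :
    homotopy ρ (gen k A Unit (Gen.of a) * w) = ρ a • homotopy ρ w :=
  homotopy_of_state ρ (state_of_mul a hw)

theorem one_mem_normal : (1 : Forms k A Unit) ∈ normal ρ := by
  rw [mem_normal, homotopy_of_state ρ (state_one ρ), state_one]
  simp

theorem homotopy_one : homotopy ρ (1 : Forms k A Unit) = 0 := by
  rw [homotopy_of_state ρ (state_one ρ)]
  simp

/-- The letter `da` acts through a commutator whose second term is `a ⊗ δ(1 ⊗ ·)` with `δ =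
stateDiff ρ`. That term vanishes: `d1 = 0`, and the correction `- ρ(a) w` makes the other entry of
`δ` vanish at `a = 1`. -/
theorem state_diff_mul (hρ : ρ 1 = 1) (a : A) {w : Forms k A Unit} (hw : w ∈ normal ρ) :
    state ρ (gen k A Unit (Gen.diff a) * w) =
      1 ⊗ₜ (gen k A Unit (Gen.diff a) * w, gen k A Unit (Gen.of a) * w - ρ a • w) := by
  rw [state_mul, (mem_normal ρ).1 hw, tensorAction_diff, leftMul_tmul, mul_one]
  have h1 : diffHom k A Unit 1 = 0 := gen_diff_one
  simp only [stateDiff, TensorProduct.lift.tmul, LinearMap.mk₂_apply, h1, zero_mul, map_one,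
    one_mul, hρ, one_smul, sub_self, ← Prod.zero_eq_mk, TensorProduct.tmul_zero, sub_zero]
  rfl

theorem homotopy_diff_mul (hρ : ρ 1 = 1) (a : A) {w : Forms k A Unit} (hw : w ∈ normal ρ) :
    homotopy ρ (gen k A Unit (Gen.diff a) * w) = gen k A Unit (Gen.of a) * w - ρ a • w := by
  rw [homotopy_of_state ρ (state_diff_mul hρ a hw), hρ, one_smul]

theorem diff_mul_mem_normal (hρ : ρ 1 = 1) (a : A) {w : Forms k A Unit} (hw : w ∈ normal ρ) :
    gen k A Unit (Gen.diff a) * w ∈ normal ρ := by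
  rw [mem_normal, homotopy_diff_mul hρ a hw, state_diff_mul hρ a hw]

theorem state_t_of_mul (a : A) {w : Forms k A Unit} (hw : w ∈ normal ρ) :
    state ρ (tVar k A * (gen k A Unit (Gen.of a) * w)) =
      1 ⊗ₜ (tVar k A * (gen k A Unit (Gen.of a) * w), ρ a • (tVar k A * homotopy ρ w)) := by
  rw [state_mul, state_of_mul a hw, tensorAction_t]
  rfl

theorem homotopy_t_of_mul (hρ : ρ 1 = 1) (a : A) {w : Forms k A Unit} (hw : w ∈ normal ρ) :
    homotopy ρ (tVar k A * (gen k A Unit (Gen.of a) * w)) =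
      ρ a • (tVar k A * homotopy ρ w) := by
  rw [homotopy_of_state ρ (state_t_of_mul a hw), hρ, one_smul]

theorem t_of_mul_mem_normal (hρ : ρ 1 = 1) (a : A) {w : Forms k A Unit} (hw : w ∈ normal ρ) :
    tVar k A * (gen k A Unit (Gen.of a) * w) ∈ normal ρ := by
  rw [mem_normal, homotopy_t_of_mul hρ a hw, state_t_of_mul a hw]

theorem t_mul_mem_normal (hρ : ρ 1 = 1) {w : Forms k A Unit} (hw : w ∈ normal ρ) :
    tVar k A * w ∈ normal ρ := by
  simpa [gen_of_one] using t_of_mul_mem_normal hρ 1 hw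

theorem homotopy_t_mul (hρ : ρ 1 = 1) {w : Forms k A Unit} (hw : w ∈ normal ρ) :
    homotopy ρ (tVar k A * w) = tVar k A * homotopy ρ w := by
  simpa [gen_of_one, hρ] using homotopy_t_of_mul hρ 1 hw

theorem t_mul_mem_scalars {x : Forms k A Unit} (hx : x ∈ scalars k A Unit) :
    tVar k A * x ∈ scalars k A Unit :=
  Subalgebra.mul_mem _ (Algebra.subset_adjoin ⟨(), rfl⟩) hx

/-- The homotopy vanishes on `k[t]`. -/
theorem homotopy_scalar (hρ : ρ 1 = 1) {x : Forms k A Unit} (hx : x ∈ scalars k A Unit) :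
    homotopy ρ x = 0 := by
  have : scalars k A Unit ≤ normal ρ ⊓ LinearMap.ker (homotopy ρ) := by
    rw [scalars_eq_span]
    refine Submodule.span_le.2 ?_
    rintro _ ⟨l, rfl⟩
    induction l with
    | nil => exact ⟨one_mem_normal, homotopy_one⟩
    | cons v l ih =>
      change word k A Unit (Gen.var v :: l.map Gen.var) ∈ _
      rw [word_cons]
      refine ⟨t_mul_mem_normal hρ ih.1, ?_⟩
      have h2 : homotopy ρ (word k A Unit (l.map Gen.var)) = 0 := ih.2
      exact (homotopy_t_mul hρ ih.1).trans (by rw [h2, mul_zero])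
  exact (this hx).2

variable (ρ) in
/-- The map `d K + K d - 1` for the homotopy `K`. -/
noncomputable def homotopyDefect : Forms k A Unit →ₗ[k] Forms k A Unit :=
  (dForms k A Unit).comp (homotopy ρ) + (homotopy ρ).comp (dForms k A Unit) - LinearMap.id

theorem homotopyDefect_apply (x : Forms k A Unit) : homotopyDefect ρ x =
    dForms k A Unit (homotopy ρ x) + homotopy ρ (dForms k A Unit x) - x := rfl

variable (ρ) in
/-- The normal forms with normal differential on which the homotopy contracts to `k[t]`. -/
noncomputable def contractible : Submodule k (Forms k A Unit) :=
  normal ρ ⊓ (normal ρ).comap (dForms k A Unit) ⊓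
    (scalars k A Unit).comap (homotopyDefect ρ)

theorem mem_contractible {w : Forms k A Unit} : w ∈ contractible ρ ↔
    w ∈ normal ρ ∧ dForms k A Unit w ∈ normal ρ ∧ homotopyDefect ρ w ∈ scalars k A Unit :=
  and_assoc

theorem one_mem_contractible : (1 : Forms k A Unit) ∈ contractible ρ := by
  refine mem_contractible.2 ⟨one_mem_normal, ?_, ?_⟩
  · simp [dForms_one]
  · rw [homotopyDefect_apply, homotopy_one, dForms_one, map_zero, map_zero, add_zero, zero_sub]
    exact Submodule.neg_mem _ (Subalgebra.one_mem _)

/-- Here the defect is zero: `dK` contributes `da w + a dw - ρ(a) dw`, and `Kd` contributes `-K(da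
dw) = -(a dw - ρ(a) dw)`. -/
theorem diff_mul_mem_contractible (hρ : ρ 1 = 1) (a : A) {w : Forms k A Unit}
    (hw : w ∈ contractible ρ) : gen k A Unit (Gen.diff a) * w ∈ contractible ρ := by
  obtain ⟨h1, h2, -⟩ := mem_contractible.1 hw
  refine mem_contractible.2 ⟨diff_mul_mem_normal hρ a h1, ?_, ?_⟩
  · rw [dForms_diff_mul]
    exact Submodule.neg_mem _ (diff_mul_mem_normal hρ a h2)
  · rw [homotopyDefect_apply, dForms_diff_mul, homotopy_diff_mul hρ a h1, map_neg,
      homotopy_diff_mul hρ a h2, map_sub, dForms_of_mul, map_smul]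
    convert Submodule.zero_mem _
    abel

/-- The homotopy passes through `t a` as the factor `ρ(a) t`, up to the term `t a w - ρ(a) t w`
coming from `K(t da w)`. The defect at `t a w` is therefore `ρ(a) t` times the defect at `w`. -/
theorem t_of_mul_mem_contractible (hρ : ρ 1 = 1) (a : A) {w : Forms k A Unit}
    (hw : w ∈ contractible ρ) :
    tVar k A * (gen k A Unit (Gen.of a) * w) ∈ contractible ρ := by
  obtain ⟨h1, h2, h3⟩ := mem_contractible.1 hw
  have hd : dForms k A Unit (tVar k A * (gen k A Unit (Gen.of a) * w)) =
      tVar k A * (gen k A Unit (Gen.diff a) * w) +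
        tVar k A * (gen k A Unit (Gen.of a) * dForms k A Unit w) := by
    rw [dForms_t_mul, dForms_of_mul, mul_add]
  refine mem_contractible.2 ⟨t_of_mul_mem_normal hρ a h1, ?_, ?_⟩
  · rw [hd]
    exact Submodule.add_mem _ (t_mul_mem_normal hρ (diff_mul_mem_normal hρ a h1))
      (t_of_mul_mem_normal hρ a h2)
  · convert Submodule.smul_mem _ (ρ a) (t_mul_mem_scalars h3) using 1
    rw [homotopyDefect_apply, hd, homotopy_t_of_mul hρ a h1, map_add, map_smul, dForms_t_mul,
      homotopy_t_mul hρ (diff_mul_mem_normal hρ a h1), homotopy_diff_mul hρ a h1,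
      homotopy_t_of_mul hρ a h2, homotopyDefect_apply]
    simp only [mul_add, mul_sub, smul_add, smul_sub, mul_smul_comm]
    abel

/-- The defect at `a w` is `ρ(a)` times the defect at `w`, since `K(da w)` supplies `a w - ρ(a) w`.
-/
theorem homotopyDefect_of_mul (hρ : ρ 1 = 1) (a : A) {w : Forms k A Unit}
    (hw : w ∈ contractible ρ) :
    homotopyDefect ρ (gen k A Unit (Gen.of a) * w) ∈ scalars k A Unit := by
  obtain ⟨h1, h2, h3⟩ := mem_contractible.1 hw
  convert Submodule.smul_mem _ (ρ a) h3 using 1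
  rw [homotopyDefect_apply, dForms_of_mul, map_add, homotopy_of_mul a h1,
    homotopy_of_mul a h2, homotopy_diff_mul hρ a h1, map_smul, homotopyDefect_apply]
  simp only [smul_add, smul_sub]
  abel

/-- Every form is a sum of forms `a w` with `w` contractible. -/
theorem mem_span_of_mul_contractible (hρ : ρ 1 = 1) (x : Forms k A Unit) :
    x ∈ Submodule.span k {y | ∃ (a : A) (w : Forms k A Unit), w ∈ contractible ρ ∧
      y = gen k A Unit (Gen.of a) * w} := by
  have hmem : ∀ (a : A) (w : Forms k A Unit), w ∈ contractible ρ →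
      gen k A Unit (Gen.of a) * w ∈ Submodule.span k {y | ∃ (a : A) (w : Forms k A Unit),
        w ∈ contractible ρ ∧ y = gen k A Unit (Gen.of a) * w} := fun a w hw =>
    Submodule.subset_span ⟨a, w, hw, rfl⟩
  refine linearMap_induction LinearMap.id _ (fun l => ?_) x
  rw [LinearMap.id_apply]
  induction l with
  | nil => simpa [word, gen_of_one] using hmem 1 1 one_mem_contractible
  | cons g l ih =>
    rw [word_cons]
    generalize word k A Unit l = y at ih
    induction ih using Submodule.span_induction with
    | mem y hy =>
      obtain ⟨a, w, hw, rfl⟩ := hy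
      cases g with
      | of b =>
        rw [← mul_assoc, ← gen_of_mul]
        exact hmem _ _ hw
      | diff b =>
        -- `db · a = d(ba) - b · da` moves the coefficient `a` back to the left.
        rw [← mul_assoc, ← sub_eq_of_eq_add (gen_diff_mul b a), sub_mul, mul_assoc]
        refine Submodule.sub_mem _ ?_ (hmem b _ (diff_mul_mem_contractible hρ a hw))
        simpa [gen_of_one] using hmem 1 _ (diff_mul_mem_contractible hρ (b * a) hw)
      | var u =>
        have := hmem 1 _ (t_of_mul_mem_contractible hρ a hw)
        rwa [gen_of_one, one_mul] at this
    | zero => simp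
    | add y z _ _ hy hz => rw [mul_add]; exact Submodule.add_mem _ hy hz
    | smul r y _ hy => rw [mul_smul_comm]; exact Submodule.smul_mem _ r hy

/-- `K` is a contraction of `Ω_t` onto `k[t]`. -/
theorem homotopyDefect_mem (hρ : ρ 1 = 1) (x : Forms k A Unit) :
    homotopyDefect ρ x ∈ scalars k A Unit := by
  have : (⊤ : Submodule k (Forms k A Unit)) ≤
      (scalars k A Unit).comap (homotopyDefect ρ) := by
    intro y _
    refine Submodule.span_le.2 ?_ (mem_span_of_mul_contractible hρ y)
    rintro _ ⟨a, w, hw, rfl⟩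
    exact homotopyDefect_of_mul hρ a hw
  exact this trivial

end Homotopy

/-! ### The cyclic derivative with respect to `t`. -/

section CyclicDerivative

variable {k : Type v} [CommRing k] {A : Type w} [Ring A] [Algebra k A] {X : Type}

variable (k A X) in
/-- The parity automorphism, `(-1) ^ p` on forms of de Rham degree `p`. -/
noncomputable def parity : Forms k A X →ₐ[k] Forms k A X :=
  lift (ofHom k A X) (-diffHom k A X)
    (by
      have h : diffHom k A X 1 = 0 := gen_diff_one
      simp [h])
    (fun a b => by
      have h : diffHom k A X (a * b) = diffHom k A X a * ofHom k A X b
        + ofHom k A X a * diffHom k A X b := gen_diff_mul a b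
      simp only [LinearMap.neg_apply, h, neg_add, neg_mul, mul_neg])
    (fun x => gen k A X (Gen.var x))

theorem parity_of (a : A) : parity k A X (gen k A X (Gen.of a)) = gen k A X (Gen.of a) :=
  lift_gen_of ..

theorem parity_diff (a : A) :
    parity k A X (gen k A X (Gen.diff a)) = -gen k A X (Gen.diff a) := lift_gen_diff ..

theorem parity_var (x : X) : parity k A X (gen k A X (Gen.var x)) = gen k A X (Gen.var x) :=
  lift_gen_var ..

theorem parity_gen (g : Gen A X) :
    parity k A X (gen k A X g) = g.deg.negOnePow • gen k A X g := by
  cases g <;> simp [parity_of, parity_diff, parity_var, Gen.deg, Units.smul_def]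

theorem parity_word (l : List (Gen A X)) :
    parity k A X (word k A X l) = (l.map Gen.deg).sum.negOnePow • word k A X l := by
  induction l with
  | nil => simp [word]
  | cons g l ih =>
    rw [word_cons, map_mul, parity_gen, ih, smul_mul_smul_comm, List.map_cons, List.sum_cons,
      Int.negOnePow_add]

theorem parity_parity (x : Forms k A X) : parity k A X (parity k A X x) = x := by
  have := linearMap_induction (((parity k A X).comp (parity k A X)).toLinearMap
    - LinearMap.id) ⊥ (fun l => ?_) x
  · simpa [sub_eq_zero] using this
  rw [Submodule.mem_bot, LinearMap.sub_apply, sub_eq_zero]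
  simp only [AlgHom.toLinearMap_apply, AlgHom.comp_apply, LinearMap.id_apply]
  rw [parity_word, Units.smul_def, map_zsmul, parity_word, Units.smul_def, smul_smul]
  simp

theorem parity_dForms (x : Forms k A X) :
    parity k A X (dForms k A X x) = -dForms k A X (parity k A X x) := by
  have := linearMap_induction ((parity k A X).toLinearMap.comp (dForms k A X)
    + (dForms k A X).comp (parity k A X).toLinearMap) ⊥ (fun l => ?_) x
  · exact eq_neg_of_add_eq_zero_left ((Submodule.mem_bot k).1 this)
  rw [Submodule.mem_bot, LinearMap.add_apply, ← eq_neg_iff_add_eq_zero]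
  simp only [LinearMap.comp_apply, AlgHom.toLinearMap_apply]
  induction l with
  | nil => simp [word, dForms_one]
  | cons g l ih =>
    rw [word_cons]
    cases g with
    | of a =>
      simp only [dForms_of_mul, map_add, map_mul, parity_of, parity_diff, ih, neg_mul, mul_neg,
        neg_add]
    | diff a =>
      simp only [dForms_diff_mul, map_neg, map_mul, parity_diff, ih, neg_mul, mul_neg]
    | var v => simp only [dForms_var_mul, map_mul, parity_var, ih, mul_neg]

/-- The graded Leibniz rule for `d`. -/
theorem dForms_mul (x y : Forms k A X) : dForms k A X (x * y) =
    dForms k A X x * y + parity k A X x * dForms k A X y := by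
  have := linearMap_induction ((dForms k A X).comp (LinearMap.mulRight k y)
    - ((LinearMap.mulRight k y).comp (dForms k A X)
      + (LinearMap.mulRight k (dForms k A X y)).comp (parity k A X).toLinearMap)) ⊥
      (fun l => ?_) x
  · exact sub_eq_zero.1 ((Submodule.mem_bot k).1 this)
  rw [Submodule.mem_bot, LinearMap.sub_apply, sub_eq_zero]
  simp only [LinearMap.add_apply, LinearMap.comp_apply, AlgHom.toLinearMap_apply,
    LinearMap.mulRight_apply]
  rw [parity_word, smul_mul_assoc]
  exact superDer_mul _ _ _ _ _ _ (word_mem_deg l) y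

theorem dForms_gen_of (a : A) :
    dForms k A X (gen k A X (Gen.of a)) = gen k A X (Gen.diff a) := by
  simpa [dForms_one] using dForms_of_mul (k := k) (X := X) a 1

theorem dForms_gen_diff (a : A) : dForms k A X (gen k A X (Gen.diff a)) = 0 := by
  simpa [dForms_one] using dForms_diff_mul (k := k) (X := X) a 1

theorem dForms_gen_var (x : X) : dForms k A X (gen k A X (Gen.var x)) = 0 := by
  simpa [dForms_one] using dForms_var_mul (k := k) (A := A) x 1

/-- The operator `(G, F) ↦ (c G ε, F (· c))` on pairs of operators. -/
noncomputable def cyclicOp (c : Forms k A Unit) (ε : Module.End k (Forms k A Unit)) :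
    Module.End k (Module.End k (Forms k A Unit) × Module.End k (Forms k A Unit)) where
  toFun f := (LinearMap.mulLeft k c * f.1 * ε, f.2 * LinearMap.mulRight k c)
  map_add' f g := by ext <;> simp [mul_add, add_mul]
  map_smul' r f := by ext <;> simp

theorem cyclicOp_fst (c : Forms k A Unit) (ε : Module.End k (Forms k A Unit))
    (f : Module.End k (Forms k A Unit) × Module.End k (Forms k A Unit)) (x : Forms k A Unit) :
    (cyclicOp c ε f).1 x = c * f.1 (ε x) := rfl

theorem cyclicOp_snd (c : Forms k A Unit) (ε : Module.End k (Forms k A Unit))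
    (f : Module.End k (Forms k A Unit) × Module.End k (Forms k A Unit)) (x : Forms k A Unit) :
    (cyclicOp c ε f).2 x = f.2 (x * c) := rfl

theorem cyclicOp_ext
    {φ ψ : Module.End k (Module.End k (Forms k A Unit) × Module.End k (Forms k A Unit))}
    (h : ∀ f x, (φ f).1 x = (ψ f).1 x ∧ (φ f).2 x = (ψ f).2 x) : φ = ψ :=
  LinearMap.ext fun f => Prod.ext (LinearMap.ext fun x => (h f x).1)
    (LinearMap.ext fun x => (h f x).2)

theorem cyclicOp_add (c c' : Forms k A Unit) (ε : Module.End k (Forms k A Unit)) :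
    cyclicOp (c + c') ε = cyclicOp c ε + cyclicOp c' ε :=
  cyclicOp_ext fun f x => by simp [cyclicOp_fst, cyclicOp_snd, add_mul, mul_add]

theorem cyclicOp_smul (r : k) (c : Forms k A Unit) (ε : Module.End k (Forms k A Unit)) :
    cyclicOp (r • c) ε = r • cyclicOp c ε :=
  cyclicOp_ext fun f x => by simp [cyclicOp_fst, cyclicOp_snd]

theorem cyclicOp_one : cyclicOp (1 : Forms k A Unit) 1 = 1 :=
  cyclicOp_ext fun f x => by simp [cyclicOp_fst, cyclicOp_snd]

theorem cyclicOp_mul (c c' : Forms k A Unit) (ε ε' : Module.End k (Forms k A Unit)) :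
    cyclicOp c ε * cyclicOp c' ε' = cyclicOp (c * c') (ε' * ε) :=
  cyclicOp_ext fun f x => by simp [cyclicOp_fst, cyclicOp_snd, mul_assoc]

variable (k A) in
/-- The action of `Ω_t` on pairs of operators that defines the cyclic derivative. -/
noncomputable def cyclicAction : Forms k A Unit →ₐ[k]
    Module.End k (Module.End k (Forms k A Unit) × Module.End k (Forms k A Unit)) :=
  lift
    (AlgHom.ofLinearMap
      { toFun := fun a => cyclicOp (gen k A Unit (Gen.of a)) 1
        map_add' := fun a b => by rw [gen_of_add, cyclicOp_add]
        map_smul' := fun r a => by rw [gen_of_smul, cyclicOp_smul]; rfl }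
      (by rw [LinearMap.coe_mk, AddHom.coe_mk, gen_of_one, cyclicOp_one])
      (fun a b => by
        rw [LinearMap.coe_mk, AddHom.coe_mk, gen_of_mul, cyclicOp_mul, mul_one]))
    { toFun := fun a => cyclicOp (gen k A Unit (Gen.diff a)) (parity k A Unit).toLinearMap
      map_add' := fun a b => by rw [gen_diff_add, cyclicOp_add]
      map_smul' := fun r a => by rw [gen_diff_smul, cyclicOp_smul]; rfl }
    (by
      rw [LinearMap.coe_mk, AddHom.coe_mk, gen_diff_one]
      exact cyclicOp_ext fun f x => by simp [cyclicOp_fst, cyclicOp_snd])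
    (fun a b => by
      simp only [LinearMap.coe_mk, AddHom.coe_mk, AlgHom.ofLinearMap_apply]
      rw [gen_diff_mul, cyclicOp_mul, cyclicOp_mul, cyclicOp_add, mul_one, one_mul])
    -- Letters are read from right to left. At a letter `t` the first component, which carries the
    -- part `v` to its right, is added to the second: this opens the summand in which that `t` is
    -- deleted. Letters further left are then appended on the right of the argument.
    (fun _ => cyclicOp (tVar k A) 1 + LinearMap.inr k _ _ ∘ₗ LinearMap.fst k _ _)

/-- `rotate w x = (-1) ^ (|x| |w|) w x`. -/
noncomputable def rotate (w : Forms k A Unit) : Forms k A Unit →ₗ[k] Forms k A Unit :=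
  (cyclicAction k A w (1, 0)).1

/-- `cyclic w x` is the sum of the terms `± v x u` over all factorizations `w = u t v`. -/
noncomputable def cyclic (w : Forms k A Unit) : Forms k A Unit →ₗ[k] Forms k A Unit :=
  (cyclicAction k A w (1, 0)).2

theorem cyclicAction_pair (w : Forms k A Unit) :
    cyclicAction k A w (1, 0) = (rotate w, cyclic w) := rfl

theorem rotate_add (w w' : Forms k A Unit) : rotate (w + w') = rotate w + rotate w' := by
  simp [rotate]

theorem rotate_neg (w : Forms k A Unit) : rotate (-w) = -rotate w := by
  simp [rotate]

theorem cyclic_add (w w' : Forms k A Unit) : cyclic (w + w') = cyclic w + cyclic w' := by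
  simp [cyclic]

theorem cyclic_neg (w : Forms k A Unit) : cyclic (-w) = -cyclic w := by
  simp [cyclic]

theorem rotate_one (x : Forms k A Unit) : rotate 1 x = x := by
  simp [rotate]

theorem cyclic_one : cyclic (1 : Forms k A Unit) = 0 := by
  simp [cyclic]

theorem cyclicAction_of_mul (a : A) (w : Forms k A Unit) :
    cyclicAction k A (gen k A Unit (Gen.of a) * w) (1, 0) =
      cyclicOp (gen k A Unit (Gen.of a)) 1 (rotate w, cyclic w) := by
  rw [map_mul, Module.End.mul_apply, cyclicAction_pair]
  exact congrArg (fun f : Module.End k (Module.End k (Forms k A Unit) ×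
    Module.End k (Forms k A Unit)) => f (rotate w, cyclic w))
    (lift_gen_of (k := k) (A := A) _ _ _ _ _ a)

theorem cyclicAction_diff_mul (a : A) (w : Forms k A Unit) :
    cyclicAction k A (gen k A Unit (Gen.diff a) * w) (1, 0) =
      cyclicOp (gen k A Unit (Gen.diff a)) (parity k A Unit).toLinearMap (rotate w, cyclic w) := by
  rw [map_mul, Module.End.mul_apply, cyclicAction_pair]
  exact congrArg (fun f : Module.End k (Module.End k (Forms k A Unit) ×
    Module.End k (Forms k A Unit)) => f (rotate w, cyclic w))
    (lift_gen_diff (k := k) (A := A) _ _ _ _ _ a)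

theorem cyclicAction_t_mul (w : Forms k A Unit) :
    cyclicAction k A (tVar k A * w) (1, 0) =
      cyclicOp (tVar k A) 1 (rotate w, cyclic w) + (0, rotate w) := by
  rw [map_mul, Module.End.mul_apply, cyclicAction_pair]
  exact congrArg (fun f : Module.End k (Module.End k (Forms k A Unit) ×
    Module.End k (Forms k A Unit)) => f (rotate w, cyclic w))
    (lift_gen_var (k := k) (A := A) _ _ _ _ _ ())

theorem rotate_of_mul (a : A) (w x : Forms k A Unit) :
    rotate (gen k A Unit (Gen.of a) * w) x = gen k A Unit (Gen.of a) * rotate w x := by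
  rw [rotate, cyclicAction_of_mul]; rfl

theorem rotate_diff_mul (a : A) (w x : Forms k A Unit) :
    rotate (gen k A Unit (Gen.diff a) * w) x =
      gen k A Unit (Gen.diff a) * rotate w (parity k A Unit x) := by
  rw [rotate, cyclicAction_diff_mul]; rfl

theorem rotate_t_mul (w x : Forms k A Unit) :
    rotate (tVar k A * w) x = tVar k A * rotate w x := by
  rw [rotate, cyclicAction_t_mul, Prod.fst_add, add_zero]; rfl

theorem cyclic_of_mul (a : A) (w x : Forms k A Unit) :
    cyclic (gen k A Unit (Gen.of a) * w) x = cyclic w (x * gen k A Unit (Gen.of a)) := by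
  rw [cyclic, cyclicAction_of_mul]; rfl

theorem cyclic_diff_mul (a : A) (w x : Forms k A Unit) :
    cyclic (gen k A Unit (Gen.diff a) * w) x = cyclic w (x * gen k A Unit (Gen.diff a)) := by
  rw [cyclic, cyclicAction_diff_mul]; rfl

theorem cyclic_t_mul (w x : Forms k A Unit) :
    cyclic (tVar k A * w) x = cyclic w (x * tVar k A) + rotate w x := by
  rw [cyclic, cyclicAction_t_mul]; rfl

theorem cyclic_gen_mul (g : Gen A Unit) (w x : Forms k A Unit) :
    cyclic (gen k A Unit g * w) x =
      cyclic w (x * gen k A Unit g) + g.wt • rotate w x := by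
  cases g with
  | of a => simp [cyclic_of_mul, Gen.wt]
  | diff a => simp [cyclic_diff_mul, Gen.wt]
  | var v => exact (cyclic_t_mul w x).trans (by simp [Gen.wt]; rfl)

theorem rotate_word (l m : List (Gen A Unit)) :
    rotate (word k A Unit l) (word k A Unit m) =
      ((l.map Gen.deg).sum * (m.map Gen.deg).sum).negOnePow • word k A Unit (l ++ m) := by
  induction l with
  | nil =>
    have : word k A Unit [] = 1 := by simp [word]
    rw [this, rotate_one]
    simp
  | cons g l ih =>
    rw [word_cons, List.cons_append, word_cons]
    cases g with
    | of a => rw [rotate_of_mul, ih, mul_smul_comm]; simp [Gen.deg]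
    | diff a =>
      rw [rotate_diff_mul, parity_word, Units.smul_def, map_zsmul, ih, Units.smul_def, smul_smul,
        mul_smul_comm, Units.smul_def]
      simp only [List.map_cons, List.sum_cons, Gen.deg, add_mul, one_mul, Int.negOnePow_add,
        Units.val_mul]
    | var v => exact (rotate_t_mul _ _).trans (by
        rw [ih, mul_smul_comm]; simp [Gen.deg]; rfl)

/-- The deleted `t` lies either in the right or in the left of the two concatenated words. In the
second case the right word is moved in front of the argument, at the cost of a Koszul sign. -/
theorem cyclic_append (l l' m : List (Gen A Unit)) :
    cyclic (word k A Unit (l ++ l')) (word k A Unit m) =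
      cyclic (word k A Unit l') (word k A Unit (m ++ l)) +
        ((l'.map Gen.deg).sum * ((m.map Gen.deg).sum + (l.map Gen.deg).sum)).negOnePow •
          cyclic (word k A Unit l) (word k A Unit (l' ++ m)) := by
  induction l generalizing m with
  | nil =>
    have : word k A Unit [] = 1 := by simp [word]
    simp [this, cyclic_one]
  | cons g l ih =>
    have ih' := ih (m ++ [g])
    rw [List.cons_append, word_cons, word_cons, cyclic_gen_mul, cyclic_gen_mul]
    simp only [word_append, word_singleton, ← mul_assoc] at ih' ⊢
    rw [ih', ← word_append, ← word_append, rotate_word, rotate_word, word_cons]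
    simp only [List.map_append, List.sum_append, List.map_cons, List.sum_cons, List.map_nil,
      List.sum_nil, add_zero, List.append_assoc, ← mul_assoc, ← add_assoc, word_append]
    rw [smul_add, ← add_assoc]
    congr 1
    cases g with
    | of a => simp [Gen.wt]
    | diff a => simp [Gen.wt]
    | var v =>
      simp only [Gen.wt, one_smul, Gen.deg, add_zero, smul_smul, ← Int.negOnePow_add]
      congr 1
      -- The two exponents of the sign differ by twice the product of the degrees of `l` and `l'`.
      rw [← mul_one ((((l.map Gen.deg).sum + (l'.map Gen.deg).sum) *
        (m.map Gen.deg).sum).negOnePow),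
        ← Int.negOnePow_even (2 * ((l.map Gen.deg).sum * (l'.map Gen.deg).sum)) (even_two_mul _),
        ← Int.negOnePow_add]
      congr 1
      ring

theorem dForms_rotate (l : List (Gen A Unit)) (x : Forms k A Unit) :
    dForms k A Unit (rotate (word k A Unit l) x) = rotate (word k A Unit l) (dForms k A Unit x) +
      rotate (dForms k A Unit (word k A Unit l)) (parity k A Unit x) := by
  induction l generalizing x with
  | nil =>
    have : word k A Unit [] = 1 := by simp [word]
    simp [this, dForms_one, rotate]
  | cons g l ih =>
    rw [word_cons]
    cases g with
    | of a =>
      simp only [rotate_of_mul, dForms_of_mul, ih, rotate_add, LinearMap.add_apply,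
        rotate_diff_mul, parity_parity, mul_add]
      abel
    | diff a =>
      simp only [rotate_diff_mul, dForms_diff_mul, ih, rotate_neg, LinearMap.neg_apply,
        parity_parity, mul_add, parity_dForms, map_neg, mul_neg, neg_add]
    | var v =>
      have hv : gen k A Unit (Gen.var v) = tVar k A := rfl
      simp only [hv, rotate_t_mul, dForms_t_mul, ih, mul_add]

/-- This is the Leibniz rule for the summands `± v x u`; deleting a `t` costs nothing because `dt =
0`. The general argument `x` is needed for the induction, which moves letters of the word into it.
-/
theorem dForms_cyclic (l : List (Gen A Unit)) (x : Forms k A Unit) :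
    dForms k A Unit (cyclic (word k A Unit l) x) = cyclic (word k A Unit l) (dForms k A Unit x) +
      cyclic (dForms k A Unit (word k A Unit l)) (parity k A Unit x) := by
  induction l generalizing x with
  | nil =>
    have : word k A Unit [] = 1 := by simp [word]
    simp [this, dForms_one, cyclic]
  | cons g l ih =>
    rw [word_cons]
    cases g with
    | of a =>
      rw [dForms_of_mul, cyclic_add, LinearMap.add_apply]
      simp only [cyclic_of_mul, ih, cyclic_diff_mul, dForms_mul, dForms_gen_of, map_add, map_mul,
        parity_of]
      abel
    | diff a =>
      rw [dForms_diff_mul, cyclic_neg, LinearMap.neg_apply]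
      simp only [cyclic_diff_mul, ih, dForms_mul, dForms_gen_diff, map_mul, parity_diff, mul_zero,
        add_zero, mul_neg, map_neg]
    | var v =>
      have hv : gen k A Unit (Gen.var v) = tVar k A := rfl
      have hd : dForms k A Unit (tVar k A) = 0 := dForms_gen_var ()
      have hp : parity k A Unit (tVar k A) = tVar k A := parity_var ()
      rw [hv, dForms_t_mul]
      simp only [cyclic_t_mul, map_add, ih, dForms_rotate, dForms_mul, hd, hp, mul_zero, add_zero,
        map_mul]
      abel

variable (k A) in
/-- The cyclic derivative with respect to `t`: the sum of `± v u` over all factorizations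
`w = u t v`. -/
noncomputable def cyclicDeriv : Forms k A Unit →ₗ[k] Forms k A Unit where
  toFun w := cyclic w 1
  map_add' x y := by rw [cyclic_add]; rfl
  map_smul' r x := by simp [cyclic]

theorem cyclicDeriv_apply (w : Forms k A Unit) : cyclicDeriv k A w = cyclic w 1 := rfl

/-- By `cyclic_append` with argument `1`, both orders of the two words give the same two terms,
multiplied by the Koszul sign and in exchanged roles; the square of the sign is `1`. -/
theorem cyclicDeriv_commutator {x : Forms k A Unit} (hx : x ∈ commutators k A Unit) :
    cyclicDeriv k A x = 0 := by
  refine (commutators_le (N := LinearMap.ker (cyclicDeriv k A)) (fun l l' => ?_)) hx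
  have h1 := cyclic_append (k := k) l l' []
  have h2 := cyclic_append (k := k) l' l []
  have hnil : word k A Unit [] = 1 := by simp [word]
  simp only [hnil, List.nil_append, List.append_nil, List.map_nil, List.sum_nil, zero_add]
    at h1 h2
  rw [LinearMap.mem_ker, Units.smul_def, map_sub, map_zsmul, cyclicDeriv_apply, cyclicDeriv_apply,
    h1, h2, ← Units.smul_def, smul_add, smul_smul, mul_comm (l'.map Gen.deg).sum]
  simp only [Int.units_mul_self, one_smul]
  abel

theorem cyclicDeriv_dForms (x : Forms k A Unit) :
    cyclicDeriv k A (dForms k A Unit x) = dForms k A Unit (cyclicDeriv k A x) := by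
  have := linearMap_induction ((cyclicDeriv k A).comp (dForms k A Unit)
    - (dForms k A Unit).comp (cyclicDeriv k A)) ⊥ (fun l => ?_) x
  · simpa [sub_eq_zero] using this
  rw [Submodule.mem_bot, LinearMap.sub_apply, sub_eq_zero]
  simp only [LinearMap.comp_apply, cyclicDeriv_apply]
  rw [dForms_cyclic, dForms_one, map_zero, zero_add, map_one (parity k A Unit)]

/-- A closed class is represented by a form that is closed only up to commutators and `k[t]`. The
`k[t]` part stays in `k[t]` under the cyclic derivative, where the homotopy vanishes. -/
theorem cyclicDeriv_scalar {x : Forms k A Unit} (hx : x ∈ scalars k A Unit) :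
    cyclicDeriv k A x ∈ scalars k A Unit := by
  have key : ∀ (l : List Unit) (s : Forms k A Unit), s ∈ scalars k A Unit →
      rotate (word k A Unit (l.map Gen.var)) s ∈ scalars k A Unit ∧
      cyclic (word k A Unit (l.map Gen.var)) s ∈ scalars k A Unit := by
    intro l
    induction l with
    | nil =>
      intro s hs
      have hnil : word k A Unit [] = 1 := by simp [word]
      rw [List.map_nil, hnil, rotate_one, cyclic_one]
      exact ⟨hs, zero_mem _⟩
    | cons u l ih =>
      intro s hs
      have hw : word k A Unit ((u :: l).map Gen.var) = tVar k A * word k A Unit (l.map Gen.var) :=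
        word_cons _ _
      rw [hw, rotate_t_mul, cyclic_t_mul]
      exact ⟨t_mul_mem_scalars (ih s hs).1, Submodule.add_mem _
        (ih _ (Subalgebra.mul_mem _ hs (Algebra.subset_adjoin ⟨(), rfl⟩))).2 (ih s hs).1⟩
  have : scalars k A Unit ≤ (scalars k A Unit).comap (cyclicDeriv k A) := by
    conv_lhs => rw [scalars_eq_span]
    refine Submodule.span_le.2 ?_
    rintro _ ⟨l, rfl⟩
    exact (key l 1 (Subalgebra.one_mem _)).2
  exact this hx

/-- This is the Euler identity: putting `t` back on the right of `± v x u` gives a cyclic rotation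
of `x u t v`, so every occurrence of `t` in the word contributes the same class. -/
theorem mk_cyclic_mul_t (l m : List (Gen A Unit)) :
    (commutators k A Unit ⊔ scalars k A Unit).mkQ
        (cyclic (word k A Unit l) (word k A Unit m) * tVar k A) =
      (l.map Gen.wt).sum • (commutators k A Unit ⊔ scalars k A Unit).mkQ
        (word k A Unit (m ++ l)) := by
  induction l generalizing m with
  | nil =>
    have hnil : word k A Unit [] = 1 := by simp [word]
    simp [hnil, cyclic_one]
  | cons g l ih =>
    have ih' := ih (m ++ [g])
    rw [word_append, word_singleton, List.append_assoc, List.singleton_append] at ih'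
    rw [word_cons, cyclic_gen_mul, add_mul, map_add, ih', List.map_cons, List.sum_cons, add_smul,
      add_comm]
    congr 1
    cases g with
    | of a => simp [Gen.wt]
    | diff a => simp [Gen.wt]
    | var v =>
      -- The new summand is `± l m t`, which is the rotation of `m t l`.
      have h := word_comm_mem (k := k) (m ++ [Gen.var v]) l
      have ht : tVar k A = word k A Unit [Gen.var v] := (word_singleton _).symm
      simp only [List.map_append, List.map_cons, List.map_nil, List.sum_append, List.sum_cons,
        List.sum_nil, Gen.deg, add_zero, List.append_assoc, List.singleton_append] at h
      rw [Gen.wt, one_smul, one_smul, rotate_word, smul_mul_assoc, ht, ← word_append,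
        List.append_assoc, mul_comm]
      exact ((Submodule.Quotient.eq _).2 (Submodule.mem_sup_left h)).symm

end CyclicDerivative

/-! ### Acyclicity of the positive part, and the recursion it permits. -/

section Exactness

variable {k : Type v} [CommRing k] [Algebra ℚ k] {A : Type w} [Ring A] [Algebra k A]

/-- The part of `DRt` of positive degree in `t` is acyclic for `d`. -/
theorem exists_dDR_eq {ρ : A →ₗ[k] k} (hρ : ρ 1 = 1) {p q : ℤ} (hq : 0 < q) {x : DRt k A}
    (hx : x ∈ gr k A Unit p q) (hd : dDR k A Unit x = 0) :
    ∃ y ∈ gr k A Unit (p - 1) q, dDR k A Unit y = x := by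
  obtain ⟨x, hx, rfl⟩ := hx
  have hd' : dForms k A Unit x ∈ commutators k A Unit ⊔ scalars k A Unit :=
    (Submodule.Quotient.mk_eq_zero _).1 hd
  obtain ⟨c, hc, s, hs, hcs⟩ := Submodule.mem_sup.1 hd'
  -- The cyclic derivative turns closedness in the quotient into closedness in `Ω_t` up to `k[t]`.
  have h1 : dForms k A Unit (cyclicDeriv k A x) = cyclicDeriv k A s := by
    rw [← cyclicDeriv_dForms, ← hcs, map_add, cyclicDeriv_commutator hc, zero_add]
  have h2 := homotopyDefect_mem hρ (cyclicDeriv k A x)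
  -- Now `h2` says that `d K(D x) - D x` lies in `k[t]`.
  rw [homotopyDefect_apply, h1, homotopy_scalar hρ (cyclicDeriv_scalar hs), add_zero] at h2
  set z := homotopy ρ (cyclicDeriv k A x)
  have h3 : (commutators k A Unit ⊔ scalars k A Unit).mkQ (cyclicDeriv k A x * tVar k A) =
      q • (commutators k A Unit ⊔ scalars k A Unit).mkQ x := by
    have := map_bideg ((commutators k A Unit ⊔ scalars k A Unit).mkQ ∘ₗ
      LinearMap.mulRight k (tVar k A) ∘ₗ cyclicDeriv k A -
        q • (commutators k A Unit ⊔ scalars k A Unit).mkQ) ⊥ (fun l _ hl => ?_) hx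
    · exact sub_eq_zero.1 ((Submodule.mem_bot k).1 this)
    · have h := mk_cyclic_mul_t (k := k) l []
      have hnil : word k A Unit [] = 1 := by simp [word]
      rw [hnil, hl, List.nil_append] at h
      rw [Submodule.mem_bot, LinearMap.sub_apply, sub_eq_zero]
      exact h
  have h4 : (commutators k A Unit ⊔ scalars k A Unit).mkQ (dForms k A Unit z * tVar k A) =
      (commutators k A Unit ⊔ scalars k A Unit).mkQ (cyclicDeriv k A x * tVar k A) := by
    refine (Submodule.Quotient.eq _).2 (Submodule.mem_sup_right ?_)
    rw [← sub_mul]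
    exact Subalgebra.mul_mem _ h2 (Algebra.subset_adjoin ⟨(), rfl⟩)
  have h5 : dDR k A Unit ((commutators k A Unit ⊔ scalars k A Unit).mkQ (z * tVar k A)) =
      q • (commutators k A Unit ⊔ scalars k A Unit).mkQ x := by
    rw [← h3, ← h4]
    change (commutators k A Unit ⊔ scalars k A Unit).mkQ (dForms k A Unit (z * tVar k A)) = _
    have ht : dForms k A Unit (tVar k A) = 0 := dForms_gen_var ()
    rw [dForms_mul, ht, mul_zero, add_zero]
  set r : k := algebraMap ℚ k (q : ℚ)⁻¹
  have hr : r * (q : k) = 1 := by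
    have : (q : k) = algebraMap ℚ k (q : ℚ) := by simp
    rw [this, ← map_mul, inv_mul_cancel₀ (by exact_mod_cast hq.ne'), map_one]
  -- Projecting the primitive to the right bidegree avoids checking that `K` and `D` are
  -- homogeneous.
  refine ⟨proj k A Unit (p - 1) q
    (r • (commutators k A Unit ⊔ scalars k A Unit).mkQ (z * tVar k A)), proj_mem _ _ _, ?_⟩
  rw [← proj_dDR, sub_add_cancel, map_smul, h5, ← Int.cast_smul_eq_zsmul k, smul_smul, hr,
    one_smul]
  exact proj_of_mem ⟨x, hx, rfl⟩

theorem mem_map_dDR_plus {ρ : A →ₗ[k] k} (hρ : ρ 1 = 1) {x : DRt k A} (hx : x ∈ plus k A)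
    (hd : dDR k A Unit x = 0) : x ∈ (plus k A).map (dDR k A Unit) := by
  refine mem_of_proj_mem _ fun p q => ?_
  rcases le_or_gt q 0 with h | h
  · rw [proj_of_mem_plus h hx]; exact zero_mem _
  · obtain ⟨y, hy, hyx⟩ := exists_dDR_eq hρ h (proj_mem p q x)
      (by rw [← proj_dDR, hd, map_zero])
    exact ⟨y, gr_le_plus h hy, hyx⟩

/-- Solution of `i_t y_j - d y_{j+1} = v_j` by recursion on `j`. -/
theorem exists_primitive {ρ : A →ₗ[k] k} (hρ : ρ 1 = 1) {p q : ℤ} (v : ℕ → DRt k A)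
    (hv : ∀ j : ℕ, v j ∈ gr k A Unit (p - 2 * j) (q + j))
    (hv0 : ∀ j : ℕ, q + j ≤ 0 → v j = 0)
    (hc : ∀ j, iDR k A (v j) = dDR k A Unit (v (j + 1)))
    {y₀ : DRt k A} (hy₀ : y₀ ∈ gr k A Unit (p + 1) (q - 1))
    (hd : dDR k A Unit (iDR k A y₀ - v 0) = 0) :
    ∃ y : DRtR k A, y 0 = y₀ ∧ (∀ j : ℕ, y j ∈ gr k A Unit (p + 1 - 2 * j) (q - 1 + j)) ∧
      ∀ j, iDR k A (y j) - dDR k A Unit (y (j + 1)) = v j := by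
  have step : ∀ (j : ℕ) (y : DRt k A), (y ∈ gr k A Unit (p + 1 - 2 * j) (q - 1 + j) ∧
      dDR k A Unit (iDR k A y - v j) = 0) → ∃ y', (y' ∈ gr k A Unit (p + 1 - 2 * (j + 1 : ℕ))
        (q - 1 + (j + 1 : ℕ)) ∧ dDR k A Unit (iDR k A y' - v (j + 1)) = 0) ∧
        dDR k A Unit y' = iDR k A y - v j := by
    rintro j y ⟨hy, hyd⟩
    have hmem : iDR k A y - v j ∈ gr k A Unit (p - 2 * j) (q + j) := by
      refine Submodule.sub_mem _ ?_ (hv j)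
      have := iDR_mem_gr hy
      rwa [show p + 1 - 2 * (j : ℤ) - 1 = p - 2 * j by ring,
        show q - 1 + (j : ℤ) + 1 = q + j by ring] at this
    have hex : ∃ y' ∈ gr k A Unit (p - 2 * j - 1) (q + j),
        dDR k A Unit y' = iDR k A y - v j := by
      -- If `q + j ≤ 0`, then `y` has negative degree in `t` and vanishes, as does `v j`, so zero
      -- continues the recursion. Otherwise the acyclicity of the positive part applies.
      rcases le_or_gt (q + j) 0 with h | h
      · rw [gr_of_neg (by omega), Submodule.mem_bot] at hy
        exact ⟨0, zero_mem _, by simp [hy, hv0 j h]⟩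
      · exact exists_dDR_eq hρ h hmem hyd
    obtain ⟨y', hy', hyy'⟩ := hex
    refine ⟨y', ⟨?_, ?_⟩, hyy'⟩
    · rwa [show p + 1 - 2 * ((j + 1 : ℕ) : ℤ) = p - 2 * j - 1 by push_cast; ring,
        show q - 1 + ((j + 1 : ℕ) : ℤ) = q + j by push_cast; ring]
    -- The solvability condition propagates: `d(i y' - v_{j+1}) = -i(i y - v_j) - i v_j = 0`.
    · rw [map_sub, dDR_iDR, hyy', map_sub, iDR_iDR, ← hc]
      simp
  choose! next hnext hnext' using step
  let y : ℕ → DRt k A := fun n => Nat.rec y₀ next n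
  have hy : ∀ j : ℕ, y j ∈ gr k A Unit (p + 1 - 2 * j) (q - 1 + j) ∧
      dDR k A Unit (iDR k A (y j) - v j) = 0 := by
    intro j
    induction j with
    | zero =>
      refine ⟨?_, hd⟩
      change y₀ ∈ _
      simpa using hy₀
    | succ j ih => exact hnext j (y j) ih
  -- The term `y j` has de Rham degree `p + 1 - 2 j`, which is negative for `j` outside this range.
  refine ⟨Finsupp.onFinset (Finset.range (p + 2).toNat) y (fun j hj => ?_), rfl,
    fun j => (hy j).1, fun j => ?_⟩
  · by_contra hn
    refine hj ?_
    have h := (hy j).1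
    rw [Finset.mem_range, not_lt] at hn
    rwa [gr_of_neg_left (by omega), Submodule.mem_bot] at h
  · change iDR k A (y j) - dDR k A Unit (next j (y j)) = v j
    rw [hnext' j (y j) (hy j)]
    abel

end Exactness

/-! ### Decomposition of `DRt ⊗ R` by homological and internal degree. -/

section Components

variable {k : Type v} [CommRing k] {A : Type w} [Ring A] [Algebra k A]

/-- The projection of `DRt ⊗ R` to its component of homological degree `l` and internal
degree `n`. -/
noncomputable def projComp (l n : ℤ) (f : DRtR k A) : DRtR k A :=
  Finsupp.onFinset f.support (fun j => proj k A Unit (l - 2 * j) (n - l + j) (f j))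
    (fun j hj => Finsupp.mem_support_iff.2 fun h => hj (by rw [h, map_zero]))

theorem projComp_apply (l n : ℤ) (f : DRtR k A) (j : ℕ) :
    projComp l n f j = proj k A Unit (l - 2 * j) (n - l + j) (f j) := rfl

theorem projComp_mem (l n : ℤ) (f : DRtR k A) : projComp l n f ∈ comp k A l n :=
  fun _ => proj_mem _ _ _

theorem projComp_of_mem {l n : ℤ} {f : DRtR k A} (hf : f ∈ comp k A l n) :
    projComp l n f = f :=
  Finsupp.ext fun j => proj_of_mem (hf j)

theorem diffU_projComp (l n : ℤ) (f : DRtR k A) :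
    diffU k A (projComp (l + 1) n f) = projComp l n (diffU k A f) := by
  ext j
  rw [diffU_apply, projComp_apply, projComp_apply, projComp_apply, diffU_apply, map_sub,
    ← proj_iDR, ← proj_dDR]
  congr 3 <;> push_cast <;> ring

theorem mem_of_projComp_mem (U : Submodule k (DRtR k A)) {f : DRtR k A}
    (h : ∀ l n, projComp l n f ∈ U) : f ∈ U := by
  classical
  choose F hF using fun j => exists_sum_proj (f j)
  -- For each power `u ^ (-j)`, these are inverse translations between bidegrees and pairs of
  -- homological and internal degrees.
  let φ : ℕ → ℤ × ℤ → ℤ × ℤ := fun j i => (i.1 + 2 * j, i.2 + i.1 + j)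
  let ψ : ℕ → ℤ × ℤ → ℤ × ℤ := fun j i => (i.1 - 2 * j, i.2 - i.1 + j)
  have hψφ : ∀ j i, ψ j (φ j i) = i := fun j i => by
    ext <;> simp only [φ, ψ] <;> ring
  have hφψ : ∀ j i, φ j (ψ j i) = i := fun j i => by
    ext <;> simp only [φ, ψ] <;> ring
  have hsum : ∑ i ∈ f.support.biUnion fun j => (F j).image (φ j), projComp i.1 i.2 f = f := by
    ext j
    rw [Finsupp.finsetSum_apply]
    by_cases hj : j ∈ f.support
    · conv_rhs => rw [← hF j ((f.support.biUnion fun j => (F j).image (φ j)).image (ψ j))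
        (fun i hi => Finset.mem_image.2 ⟨φ j i, Finset.mem_biUnion.2
          ⟨j, hj, Finset.mem_image_of_mem _ hi⟩, hψφ j i⟩)]
      rw [Finset.sum_image (fun a _ b _ hab => by rw [← hφψ j a, ← hφψ j b, hab])]
      rfl
    · have h0 : f j = 0 := Finsupp.notMem_support_iff.1 hj
      simp [projComp_apply, h0]
  rw [← hsum]
  exact Submodule.sum_mem _ fun i _ => h _ _

end Components

/-! ### Criteria for a cycle to be a boundary. -/

section Boundaries

variable {k : Type v} [CommRing k] [Algebra ℚ k] {A : Type w} [Ring A] [Algebra k A]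

/-- A homogeneous cycle is a boundary if its leading coefficient is exact and the other
coefficients have positive degree in `t`. -/
theorem exists_diffU_eq_of_mem_comp {ρ : A →ₗ[k] k} (hρ : ρ 1 = 1) {l n : ℤ} {v : DRtR k A}
    (hv : v ∈ comp k A l n) (hc : diffU k A v = 0) {w : DRt k A} (hw : v 0 = dDR k A Unit w)
    (hv0 : ∀ j : ℕ, n - l + (j + 1) ≤ 0 → v (j + 1) = 0) :
    ∃ y ∈ comp k A (l + 1) n, diffU k A y = v := by
  have hc' : ∀ j, iDR k A (v j) = dDR k A Unit (v (j + 1)) := fun j => by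
    rw [← sub_eq_zero, ← diffU_apply, hc]; rfl
  have hw' : v 0 = dDR k A Unit (proj k A Unit (l - 1) (n - l) w) := by
    have h := hv 0
    rw [Nat.cast_zero, mul_zero, sub_zero, add_zero] at h
    rw [← proj_dDR, ← hw, sub_add_cancel, proj_of_mem h]
  -- The primitive has no `u ^ 0` term, so its coefficient of `u ^ (-1)` must be a `d`-primitive of
  -- `-v 0`. The remaining equations are the recursion for the coefficients of `v` shifted by one.
  obtain ⟨y, hy0, hy, hyv⟩ := exists_primitive hρ (p := l - 2) (q := n - l + 1)
    (fun j => v (j + 1))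
    (fun j => by
      have := hv (j + 1)
      rwa [show l - 2 * ((j + 1 : ℕ) : ℤ) = l - 2 - 2 * j by push_cast; ring,
        show n - l + ((j + 1 : ℕ) : ℤ) = n - l + 1 + j by push_cast; ring] at this)
    (fun j h => hv0 j (by omega)) (fun j => hc' (j + 1))
    (y₀ := -proj k A Unit (l - 1) (n - l) w)
    (by
      rw [show l - 2 + 1 = l - 1 by ring, show n - l + 1 - 1 = n - l by ring]
      exact Submodule.neg_mem _ (proj_mem _ _ _))
    (by
      rw [map_sub, dDR_iDR, map_neg (dDR k A Unit), ← hw', map_neg, neg_neg, hc', sub_self])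
  refine ⟨mulUInv k A 1 y, fun j => ?_, Finsupp.ext fun j => ?_⟩
  · cases j with
    | zero => rw [mulUInv_apply_of_lt _ _ _ one_pos]; exact zero_mem _
    | succ j =>
      rw [mulUInv_apply_add]
      have := hy j
      rwa [show l + 1 - 2 * ((j + 1 : ℕ) : ℤ) = l - 2 + 1 - 2 * j by push_cast; ring,
        show n - (l + 1) + ((j + 1 : ℕ) : ℤ) = n - l + 1 - 1 + j by push_cast; ring]
  · rw [diffU_apply, mulUInv_apply_add]
    cases j with
    | zero => rw [mulUInv_apply_of_lt _ _ _ one_pos, hy0, hw', map_zero, map_neg]; abel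
    | succ j => rw [mulUInv_apply_add]; exact hyv j

/-- A cycle is a boundary if its leading coefficient is exact and the other coefficients lie in
the part of positive degree in `t`. -/
theorem exists_diffU_eq {ρ : A →ₗ[k] k} (hρ : ρ 1 = 1) {v : DRtR k A}
    (hc : diffU k A v = 0) {w : DRt k A} (hw : v 0 = dDR k A Unit w)
    (hv : ∀ j : ℕ, v (j + 1) ∈ plus k A) : ∃ y, diffU k A y = v := by
  -- All hypotheses pass to homogeneous components. A component of `v (j + 1)` of nonpositive degree
  -- in `t` is zero because `v (j + 1)` lies in the positive part.
  refine mem_of_projComp_mem (LinearMap.range (diffU k A)) fun l n => ?_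
  obtain ⟨y, -, hy⟩ := exists_diffU_eq_of_mem_comp hρ (projComp_mem l n v)
    (by
      have := diffU_projComp (l - 1) n v
      rw [sub_add_cancel, hc] at this
      rw [this]
      ext j
      rw [projComp_apply, Finsupp.zero_apply, map_zero])
    (w := proj k A Unit (l - 1) (n - l) w)
    (by
      rw [← proj_dDR, ← hw, projComp_apply]
      congr 2 <;> simp)
    (fun j hj => by
      rw [projComp_apply]
      exact proj_of_mem_plus (by push_cast; omega) (hv j))
  exact ⟨y, hy⟩

end Boundaries

/-! ### Homology classes and their representatives. -/

section Homology

variable {k : Type v} [CommRing k] {M N : Type*} [AddCommGroup M] [Module k M] [AddCommGroup N]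
  [Module k N]

theorem Homology.exists_cls {D : M →ₗ[k] M} {Z B : Submodule k M} (c : Homology D Z B) :
    ∃ z hz, c = Homology.cls B z hz := by
  obtain ⟨⟨z, hz⟩, rfl⟩ := Submodule.Quotient.mk_surjective _ c
  exact ⟨z, hz, rfl⟩

theorem Homology.cls_eq_zero {D : M →ₗ[k] M} {Z B : Submodule k M} {z : M}
    {hz : z ∈ LinearMap.ker D ⊓ Z} : Homology.cls B z hz = 0 ↔ ∃ y ∈ B, D y = z :=
  (Submodule.Quotient.mk_eq_zero _).trans Iff.rfl

theorem Homology.cls_eq {D : M →ₗ[k] M} {Z B : Submodule k M} {z z' : M}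
    {hz : z ∈ LinearMap.ker D ⊓ Z} {hz' : z' ∈ LinearMap.ker D ⊓ Z} :
    Homology.cls B z hz = Homology.cls B z' hz' ↔ ∃ y ∈ B, D y = z - z' :=
  (Submodule.Quotient.eq _).trans Iff.rfl

end Homology

/-! ### Weight components, the maps `π_m` and `π_-`, and sections of `d`. -/

section Main

variable {k : Type v} [CommRing k] {A : Type w} [Ring A] [Algebra k A]

theorem toEHC_cls {l m : ℤ} {z : DRtR k A}
    (hz : z ∈ LinearMap.ker (diffU k A) ⊓ comp k A l (l - m)) :
    toEHC k A l m (Homology.cls _ z hz) = Homology.cls (Z := ⊤) ⊤ z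
      (Submodule.mem_inf.2 ⟨hz.1, Submodule.mem_top⟩) := rfl

/-- The differential is homogeneous, so the suitable component of any primitive of a homogeneous
cycle is again a primitive. -/
theorem toEHC_injective (l m : ℤ) : Function.Injective (toEHC k A l m) := by
  rw [injective_iff_map_eq_zero]
  intro c hc
  obtain ⟨z, hz, rfl⟩ := Homology.exists_cls c
  obtain ⟨y, -, rfl⟩ := Homology.cls_eq_zero.1 ((toEHC_cls hz).symm.trans hc)
  refine Homology.cls_eq_zero.2 ⟨projComp (l + 1) (l - m) y, projComp_mem _ _ _, ?_⟩
  rw [diffU_projComp, projComp_of_mem hz.2]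

theorem eq_dDR_incl_of_modT {p : ℤ} {x : DRt k A} {g : DR0 k A} (hx : x ∈ gr k A Unit p 0)
    (h : dDR k A Empty g = modT k A x) : x = dDR k A Unit (incl k A g) := by
  rw [← incl_modT hx, ← h, incl_dDR]

/-- In internal degree `l - m` the coefficient of `u ^ (-j)` has degree `j - m` in `t`. This and the
next lemma say where that degree is positive and where it is negative. -/
theorem mem_plus_of_mem_comp {l m : ℤ} {f : DRtR k A} (hf : f ∈ comp k A l (l - m)) {j : ℕ}
    (hj : m < j) : f j ∈ plus k A :=
  gr_le_plus (by omega) (hf j)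

theorem eq_zero_of_mem_comp {l m : ℤ} {f : DRtR k A} (hf : f ∈ comp k A l (l - m)) {j : ℕ}
    (hj : (j : ℤ) < m) : f j = 0 := by
  have h := hf j
  rwa [gr_of_neg (by omega), Submodule.mem_bot] at h

theorem single_mem_comp {l n : ℤ} {j : ℕ} {x : DRt k A}
    (hx : x ∈ gr k A Unit (l - 2 * j) (n - l + j)) : Finsupp.single j x ∈ comp k A l n := by
  classical
  intro i
  rw [Finsupp.single_apply]
  split_ifs with h
  · rw [← h]; exact hx
  · exact zero_mem _

/-! ### Sections of `d` -/

theorem IsInverseImage.mem_plus {s : DRt k A → DRt k A} {x : DRt k A} {z : DRtR k A}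
    (hs : IsSection s) (hz : IsInverseImage s x z)
    (hx : ∀ j : ℕ, iDR k A ((fun y => s (iDR k A y))^[j] x) ∈ (plus k A).map (dDR k A Unit)) :
    (∀ j, z (j + 1) ∈ plus k A) ∧ ∀ j, iDR k A (z j) - dDR k A Unit (z (j + 1)) = 0 := by
  have hsucc : ∀ j, z (j + 1) = s (iDR k A (z j)) := fun j => sub_eq_zero.1 (hz.succ j)
  have hiter : ∀ j, z j = (fun y => s (iDR k A y))^[j] x := by
    intro j
    induction j with
    | zero => exact hz.zero
    | succ j ih => rw [Function.iterate_succ_apply', hsucc, ih]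
  have hmem : ∀ j, iDR k A (z j) ∈ (plus k A).map (dDR k A Unit) := fun j => by
    rw [hiter]; exact hx j
  refine ⟨fun j => ?_, fun j => ?_⟩
  · rw [hsucc]; exact hs.mem _ (hmem j)
  · rw [hsucc, hs.d_apply _ (hmem j), sub_self]

theorem degLE_of_neg {p : ℤ} (h : p < 0) : degLE k A p = ⊥ := by
  rw [eq_bot_iff]
  exact iSup_le fun i => iSup_le fun hi => iSup_le fun q => (gr_of_neg_left (by omega)).le

theorem exists_mem_degLE (x : DRt k A) : ∃ p, x ∈ degLE k A p := by
  obtain ⟨F, hF⟩ := exists_sum_proj x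
  obtain ⟨p, hp⟩ := (F.image Prod.fst).bddAbove
  refine ⟨p, ?_⟩
  rw [← hF F subset_rfl]
  refine Submodule.sum_mem _ fun i hi => ?_
  have hle : gr k A Unit i.1 i.2 ≤ degLE k A p :=
    le_iSup_of_le i.1 (le_iSup_of_le (hp (Finset.mem_coe.2 (Finset.mem_image_of_mem _ hi)))
      (le_iSup_of_le i.2 le_rfl))
  exact hle (proj_mem _ _ _)

theorem iDR_mem_degLE {p : ℤ} {x : DRt k A} (hx : x ∈ degLE k A p) :
    iDR k A x ∈ degLE k A (p - 1) := by
  have : degLE k A p ≤ (degLE k A (p - 1)).comap (iDR k A) :=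
    iSup_le fun i => iSup_le fun hi => iSup_le fun q y hy =>
      (le_iSup_of_le (i - 1) (le_iSup_of_le (by omega) (le_iSup_of_le (q + 1) le_rfl)) :
        gr k A Unit (i - 1) (q + 1) ≤ degLE k A (p - 1)) (iDR_mem_gr hy)
  exact this hx

theorem exists_isInverseImage {s : DRt k A → DRt k A} (hs : LowersDegree s) (x : DRt k A)
    (hx : ∀ j : ℕ, iDR k A ((fun y => s (iDR k A y))^[j] x) ∈ (plus k A).map (dDR k A Unit)) :
    ∃ z, IsInverseImage s x z := by
  obtain ⟨p, hp⟩ := exists_mem_degLE x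
  have hdeg : ∀ j : ℕ, (fun y => s (iDR k A y))^[j] x ∈ degLE k A (p - 2 * j) := by
    intro j
    induction j with
    | zero => simpa using hp
    | succ j ih =>
      rw [Function.iterate_succ_apply']
      -- Each round lowers the de Rham degree by two: once by `i_t`, once by the section. Hence the
      -- sum is finite.
      refine hs _ _ (hx j) ?_
      have := iDR_mem_degLE ih
      rwa [show p - 2 * (j : ℤ) - 1 = p - 2 * ((j + 1 : ℕ) : ℤ) + 1 by push_cast; ring] at this
  refine ⟨Finsupp.onFinset (Finset.range (p + 1).toNat) (fun j => (fun y => s (iDR k A y))^[j] x)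
    (fun j hj => ?_), rfl, fun j => ?_⟩
  · by_contra hn
    refine hj ?_
    have h := hdeg j
    rw [Finset.mem_range, not_lt] at hn
    rwa [degLE_of_neg (by omega), Submodule.mem_bot] at h
  · change (fun y => s (iDR k A y))^[j + 1] x - s (iDR k A ((fun y => s (iDR k A y))^[j] x)) = 0
    rw [Function.iterate_succ_apply', sub_self]

/-- Values of `i_t` lie in the positive part, so by acyclicity they only need to be closed. This
persists: `d i_t s(i_t y) = -i_t d s(i_t y) = -i_t i_t y = 0`. -/
theorem iterate_mem [Algebra ℚ k] {ρ : A →ₗ[k] k} (hρ : ρ 1 = 1) {s : DRt k A → DRt k A} (hs : IsSection s)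
    {x : DRt k A} (hx : dDR k A Unit (iDR k A x) = 0) (j : ℕ) :
    iDR k A ((fun y => s (iDR k A y))^[j] x) ∈ (plus k A).map (dDR k A Unit) := by
  induction j with
  | zero => exact mem_map_dDR_plus hρ (iDR_mem_plus _) hx
  | succ j ih =>
    refine mem_map_dDR_plus hρ (iDR_mem_plus _) ?_
    rw [Function.iterate_succ_apply', dDR_iDR, hs.d_apply _ ih, iDR_iDR, neg_zero]

/-! ### Homogeneous cycles with given leading term, and bijectivity of `π_m` and `π_-`. -/

theorem exists_cycle_pos [Algebra ℚ k] {ρ : A →ₗ[k] k} (hρ : ρ 1 = 1) {l : ℤ} {m : ℕ} {f : DR0 k A}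
    (hf : f ∈ LinearMap.ker (dDR k A Empty) ⊓ gr k A Empty (l - 2 * m) 0) :
    ∃ w ∈ LinearMap.ker (diffU k A) ⊓ comp k A l (l - m), w m = incl k A f := by
  have hd : dDR k A Unit (incl k A f) = 0 := by
    rw [← incl_dDR, LinearMap.mem_ker.1 hf.1, map_zero]
  -- With zero right-hand side the recursion produces cycles. It starts at `f`, of bidegree `(p + 1,
  -- q - 1)`, and multiplication by `u ^ (-m)` then puts `f` at position `m`.
  obtain ⟨y, hy0, hy, hyv⟩ := exists_primitive hρ (p := l - 2 * m - 1) (q := 1) (fun _ => 0)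
    (fun _ => zero_mem _) (fun _ _ => rfl) (fun _ => by simp) (y₀ := incl k A f)
    (by simpa using incl_mem_gr hf.2) (by rw [sub_zero, dDR_iDR, hd, map_zero, neg_zero])
  refine ⟨mulUInv k A m y, ⟨Finsupp.ext fun j => ?_, fun j => ?_⟩, ?_⟩
  · rw [diffU_apply, Finsupp.zero_apply]
    rcases lt_trichotomy (j + 1) m with h | h | h
    · rw [mulUInv_apply_of_lt _ _ _ h, mulUInv_apply_of_lt _ _ _ (by omega), map_zero, map_zero,
        sub_zero]
    · have := mulUInv_apply_add m y 0
      rw [zero_add, ← h, hy0] at this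
      rw [mulUInv_apply_of_lt _ _ _ (by omega), ← h, this, hd, map_zero, sub_zero]
    · obtain ⟨i, rfl⟩ := Nat.exists_eq_add_of_le' (Nat.lt_succ_iff.1 h)
      rw [add_right_comm, mulUInv_apply_add, mulUInv_apply_add]
      exact hyv i
  -- The component condition holds because `y i` sits at position `i + m` after the shift.
  · rcases lt_or_ge j m with h | h
    · rw [mulUInv_apply_of_lt _ _ _ h]; exact zero_mem _
    · obtain ⟨i, rfl⟩ := Nat.exists_eq_add_of_le' h
      rw [mulUInv_apply_add]
      have := hy i
      rwa [show l - 2 * (m : ℤ) - 1 + 1 - 2 * i = l - 2 * ((i + m : ℕ) : ℤ) by push_cast; ring,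
        show (1 : ℤ) - 1 + i = l - m - l + ((i + m : ℕ) : ℤ) by push_cast; ring] at this
  · have := mulUInv_apply_add m y 0
    rwa [zero_add, hy0] at this

theorem piPos_cls {l : ℤ} {m : ℕ} (hm : 0 < m) {z : DRtR k A}
    (hz : z ∈ LinearMap.ker (diffU k A) ⊓ comp k A l (l - m)) :
    ∃ h, piPos k A l m hm (Homology.cls _ z hz) = Homology.cls _ (modT k A (z m)) h :=
  ⟨_, rfl⟩

theorem piPos_cls_of_eq {l : ℤ} {m : ℕ} (hm : 0 < m) {z : DRtR k A}
    (hz : z ∈ LinearMap.ker (diffU k A) ⊓ comp k A l (l - m)) {f : DR0 k A}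
    (hf : f ∈ LinearMap.ker (dDR k A Empty) ⊓ gr k A Empty (l - 2 * m) 0)
    (h : z m = incl k A f) :
    piPos k A l m hm (Homology.cls _ z hz) = Homology.cls _ f hf := by
  obtain ⟨h', e⟩ := piPos_cls hm hz
  rw [e]
  congr 1
  rw [h, modT_incl]

theorem piPos_bijective [Algebra ℚ k] {ρ : A →ₗ[k] k} (hρ : ρ 1 = 1) (l : ℤ) (m : ℕ) (hm : 0 < m) :
    Function.Bijective (piPos k A l m hm) := by
  constructor
  · rw [injective_iff_map_eq_zero]
    intro c hc
    obtain ⟨z, hz, rfl⟩ := Homology.exists_cls c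
    obtain ⟨h', e⟩ := piPos_cls hm hz
    rw [e, Homology.cls_eq_zero] at hc
    obtain ⟨g, hg, hgz⟩ := hc
    have hzm : z m ∈ gr k A Unit (l - 2 * m) 0 := by
      have := hz.2 m
      rwa [show l - (m : ℤ) - l + m = 0 by ring] at this
    have hzg := eq_dDR_incl_of_modT hzm hgz
    -- Adding the boundary of `g u^(-(m+1))` cancels `z m = dg`. The sum has no coefficients up to
    -- position `m`, and the later ones have positive degree in `t`.
    have hy : Finsupp.single (m + 1) (incl k A g) ∈ comp k A (l + 1) (l - m) := by
      refine single_mem_comp ?_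
      have := incl_mem_gr hg
      rwa [show l - 2 * (m : ℤ) - 1 = l + 1 - 2 * ((m + 1 : ℕ) : ℤ) by push_cast; ring,
        show (0 : ℤ) = l - m - (l + 1) + ((m + 1 : ℕ) : ℤ) by push_cast; ring] at this
    have hdy := diffU_mem_comp hy
    rw [add_sub_cancel_right] at hdy
    have hv := Submodule.add_mem _ hz.2 hdy
    obtain ⟨y, hy', hyz⟩ := exists_diffU_eq_of_mem_comp hρ hv
      (by rw [map_add, diffU_diffU, LinearMap.mem_ker.1 hz.1, add_zero]) (w := 0)
      (by rw [map_zero (dDR k A Unit)]; exact eq_zero_of_mem_comp hv (by simpa using hm))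
      (fun j hj => by
        rcases lt_or_eq_of_le (show j + 1 ≤ m by omega) with h | h
        · exact eq_zero_of_mem_comp hv (by omega)
        · rw [Finsupp.add_apply, diffU_apply, h, hzg, Finsupp.single_eq_same,
            Finsupp.single_eq_of_ne (Nat.succ_ne_self m).symm, map_zero (iDR k A), zero_sub,
            add_neg_cancel])
    refine Homology.cls_eq_zero.2 ⟨y - Finsupp.single (m + 1) (incl k A g),
      Submodule.sub_mem _ hy' hy, ?_⟩
    rw [map_sub, hyz, add_sub_cancel_right]
  · intro c
    obtain ⟨f, hf, rfl⟩ := Homology.exists_cls c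
    obtain ⟨w, hw, hwf⟩ := exists_cycle_pos hρ hf
    exact ⟨Homology.cls _ w hw, piPos_cls_of_eq hm hw hf hwf⟩

/-- Only the class of `x` modulo `im d` is homogeneous; `x'` is a homogeneous representative from
which a homogeneous cycle can be built. -/
theorem exists_of_mkQ_mem {l m : ℤ} {x : DRt k A}
    (hx : (LinearMap.range (dDR k A Unit)).mkQ x ∈
      LinearMap.ker (iQuot k A) ⊓ grQuot k A l (-m)) :
    ∃ x' ∈ gr k A Unit l (-m), (∃ w, x - x' = dDR k A Unit w) ∧
      iDR k A x ∈ LinearMap.range (dDR k A Unit) := by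
  obtain ⟨h1, x', hx', h⟩ := hx
  obtain ⟨w, hw⟩ := (Submodule.Quotient.eq _).1 h
  refine ⟨x', hx', ⟨-w, by rw [map_neg, hw, neg_sub]⟩, ?_⟩
  exact (Submodule.Quotient.mk_eq_zero _).1 (LinearMap.mem_ker.1 h1)

theorem exists_cycle_neg [Algebra ℚ k] {ρ : A →ₗ[k] k} (hρ : ρ 1 = 1) {l m : ℤ} {x : DRt k A}
    (hx : (LinearMap.range (dDR k A Unit)).mkQ x ∈
      LinearMap.ker (iQuot k A) ⊓ grQuot k A l (-m)) :
    ∃ z ∈ LinearMap.ker (diffU k A) ⊓ comp k A l (l - m), ∃ w, x - z 0 = dDR k A Unit w := by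
  obtain ⟨x', hx', ⟨w, hw⟩, u, hu⟩ := exists_of_mkQ_mem hx
  -- Since `x - x'` and `i_t x` are exact and `d` anticommutes with `i_t`, the form `i_t x'` is
  -- closed.
  have hd : dDR k A Unit (iDR k A x') = 0 := by
    rw [← sub_sub_cancel x x', hw, map_sub, ← hu, map_sub, dDR_dDR, dDR_iDR, dDR_dDR]
    simp
  obtain ⟨y, hy0, hy, hyv⟩ := exists_primitive hρ (p := l - 1) (q := 1 - m) (fun _ => 0)
    (fun _ => zero_mem _) (fun _ _ => rfl) (fun _ => by simp) (y₀ := x')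
    (by rwa [sub_add_cancel, sub_sub_cancel_left])
    (by rw [sub_zero, hd])
  refine ⟨y, ⟨Finsupp.ext fun j => ?_, fun j => ?_⟩, w, by rw [hy0, hw]⟩
  · rw [diffU_apply]; exact hyv j
  · have := hy j
    rwa [sub_add_cancel, show 1 - m - 1 = l - m - l by ring] at this

theorem piNeg_cls {l m : ℤ} {z : DRtR k A}
    (hz : z ∈ LinearMap.ker (diffU k A) ⊓ comp k A l (l - m)) :
    ∃ h, piNeg k A l m (Homology.cls _ z hz) =
      Homology.cls _ ((LinearMap.range (dDR k A Unit)).mkQ (z 0)) h :=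
  ⟨_, rfl⟩

theorem piNeg_cls_of_eq {l m : ℤ} {z : DRtR k A}
    (hz : z ∈ LinearMap.ker (diffU k A) ⊓ comp k A l (l - m)) {x w : DRt k A}
    (hx : (LinearMap.range (dDR k A Unit)).mkQ x ∈
      LinearMap.ker (iQuot k A) ⊓ grQuot k A l (-m))
    (h : x - z 0 = dDR k A Unit w) :
    piNeg k A l m (Homology.cls _ z hz) =
      Homology.cls _ ((LinearMap.range (dDR k A Unit)).mkQ x) hx := by
  obtain ⟨h', e⟩ := piNeg_cls hz
  rw [e]
  congr 1
  exact ((Submodule.Quotient.eq (LinearMap.range (dDR k A Unit))).2 ⟨w, h.symm⟩).symm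

theorem piNeg_bijective [Algebra ℚ k] {ρ : A →ₗ[k] k} (hρ : ρ 1 = 1) {l m : ℤ} (hm : m ≤ 0) :
    Function.Bijective (piNeg k A l m) := by
  constructor
  · rw [injective_iff_map_eq_zero]
    intro c hc
    obtain ⟨z, hz, rfl⟩ := Homology.exists_cls c
    obtain ⟨h', e⟩ := piNeg_cls hz
    rw [e, Homology.cls_eq_zero] at hc
    obtain ⟨_, ⟨y₀, hy₀, rfl⟩, hyz⟩ := hc
    obtain ⟨w, hw⟩ := (Submodule.Quotient.eq _).1 hyz.symm
    -- Subtracting the boundary of `y₀ u^0` leaves an exact leading coefficient. As `m ≤ 0`, the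
    -- later coefficients have degree `j + 1 - m > 0` in `t`.
    have hy : Finsupp.single 0 y₀ ∈ comp k A (l + 1) (l - m) := by
      refine single_mem_comp ?_
      rwa [Nat.cast_zero, mul_zero, sub_zero, add_zero, show l - m - (l + 1) = -m - 1 by ring]
    have hdy := diffU_mem_comp hy
    rw [add_sub_cancel_right] at hdy
    have hv := Submodule.sub_mem _ hz.2 hdy
    obtain ⟨y, hy', hyz⟩ := exists_diffU_eq_of_mem_comp hρ hv
      (by rw [map_sub, diffU_diffU, LinearMap.mem_ker.1 hz.1, sub_zero]) (w := w)
      (by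
        rw [hw, Finsupp.sub_apply, diffU_apply, Finsupp.single_eq_same,
          Finsupp.single_eq_of_ne (Nat.succ_ne_zero 0), map_zero (dDR k A Unit), sub_zero])
      (fun j hj => by omega)
    refine Homology.cls_eq_zero.2 ⟨y + Finsupp.single 0 y₀, Submodule.add_mem _ hy' hy, ?_⟩
    rw [map_add, hyz, sub_add_cancel]
  · intro c
    obtain ⟨x, hx, rfl⟩ := Homology.exists_cls c
    obtain ⟨x, rfl⟩ := Submodule.mkQ_surjective _ x
    obtain ⟨z, hz, w, hw⟩ := exists_cycle_neg hρ hx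
    exact ⟨Homology.cls _ z hz, piNeg_cls_of_eq hz hx hw⟩

/-! ### The cycles given by a section of `d` represent the inverse images under `π_m` and `π_-`. -/

theorem cls_mulUInv_eq [Algebra ℚ k] {ρ : A →ₗ[k] k} (hρ : ρ 1 = 1) {l : ℤ} {m : ℕ} (hm : 0 < m)
    {s : DRt k A → DRt k A} (hs : IsSection s) {f : DR0 k A}
    (hf : f ∈ LinearMap.ker (dDR k A Empty) ⊓ gr k A Empty (l - 2 * m) 0)
    {z : DRtR k A} (hz : IsInverseImage s (incl k A f) z)
    (hx : ∀ j : ℕ, iDR k A ((fun y => s (iDR k A y))^[j] (incl k A f)) ∈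
      (plus k A).map (dDR k A Unit))
    {w : DRtR k A} (hw : w ∈ LinearMap.ker (diffU k A) ⊓ comp k A l (l - m))
    (hwf : w m = incl k A f) :
    ∃ hz : mulUInv k A m z ∈ LinearMap.ker (diffU k A) ⊓ ⊤,
      Homology.cls ⊤ (mulUInv k A m z) hz = toEHC k A l m (Homology.cls _ w hw) := by
  obtain ⟨hplus, hcyc⟩ := hz.mem_plus hs hx
  have hd : dDR k A Unit (incl k A f) = 0 := by
    rw [← incl_dDR, LinearMap.mem_ker.1 hf.1, map_zero]
  have h0 : mulUInv k A m z m = incl k A f := by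
    have := mulUInv_apply_add m z 0
    rwa [zero_add, hz.zero] at this
  have hcycle : diffU k A (mulUInv k A m z) = 0 := by
    ext j
    rw [diffU_apply, Finsupp.zero_apply]
    rcases lt_trichotomy (j + 1) m with h | h | h
    · rw [mulUInv_apply_of_lt _ _ _ h, mulUInv_apply_of_lt _ _ _ (by omega), map_zero, map_zero,
        sub_zero]
    · rw [mulUInv_apply_of_lt _ _ _ (by omega), h, h0, hd, map_zero, sub_zero]
    · obtain ⟨i, rfl⟩ := Nat.exists_eq_add_of_le' (Nat.lt_succ_iff.1 h)
      rw [add_right_comm, mulUInv_apply_add, mulUInv_apply_add]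
      exact hcyc i
  refine ⟨Submodule.mem_inf.2 ⟨LinearMap.mem_ker.2 hcycle, Submodule.mem_top⟩,
    (Homology.cls_eq.2 ?_).trans (toEHC_cls hw).symm⟩
  -- Both cycles vanish below position `m` and have the coefficient `f` there, so their difference
  -- lives in positive degree in `t`. It need not be homogeneous, because `s` need not be.
  obtain ⟨y, hy⟩ := exists_diffU_eq hρ (v := mulUInv k A m z - w) (w := 0)
    (by rw [map_sub, hcycle, LinearMap.mem_ker.1 hw.1, sub_zero])
    (by
      rw [Finsupp.sub_apply, mulUInv_apply_of_lt _ _ _ hm, eq_zero_of_mem_comp hw.2 (by simpa),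
        sub_zero, map_zero])
    (fun j => by
      rw [Finsupp.sub_apply]
      rcases lt_trichotomy (j + 1) m with h | h | h
      · rw [mulUInv_apply_of_lt _ _ _ h, eq_zero_of_mem_comp hw.2 (by omega), sub_zero]
        exact zero_mem _
      · rw [h, h0, hwf, sub_self]; exact zero_mem _
      · refine Submodule.sub_mem _ ?_ (mem_plus_of_mem_comp hw.2 (by omega))
        obtain ⟨i, rfl⟩ := Nat.exists_eq_add_of_le' (Nat.lt_succ_iff.1 h)
        rw [add_right_comm, mulUInv_apply_add]
        exact hplus i)
  exact ⟨y, Submodule.mem_top, hy⟩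

theorem cls_eq_toEHC [Algebra ℚ k] {ρ : A →ₗ[k] k} (hρ : ρ 1 = 1) {l m : ℤ} (hm : m ≤ 0)
    {s : DRt k A → DRt k A} (hs : IsSection s) {x : DRt k A}
    {z : DRtR k A} (hz : IsInverseImage s x z)
    (hx : ∀ j : ℕ, iDR k A ((fun y => s (iDR k A y))^[j] x) ∈ (plus k A).map (dDR k A Unit))
    {z' : DRtR k A} (hz' : z' ∈ LinearMap.ker (diffU k A) ⊓ comp k A l (l - m))
    {w : DRt k A} (hw : x - z' 0 = dDR k A Unit w) :
    ∃ hz : z ∈ LinearMap.ker (diffU k A) ⊓ ⊤,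
      Homology.cls ⊤ z hz = toEHC k A l m (Homology.cls _ z' hz') := by
  obtain ⟨hplus, hcyc⟩ := hz.mem_plus hs hx
  have hcycle : diffU k A z = 0 := by
    ext j
    rw [diffU_apply]
    exact hcyc j
  refine ⟨Submodule.mem_inf.2 ⟨LinearMap.mem_ker.2 hcycle, Submodule.mem_top⟩,
    (Homology.cls_eq.2 ?_).trans (toEHC_cls hz').symm⟩
  -- The leading coefficients agree modulo `im d`; all later ones lie in the positive part.
  obtain ⟨y, hy⟩ := exists_diffU_eq hρ (v := z - z') (w := w)
    (by rw [map_sub, hcycle, LinearMap.mem_ker.1 hz'.1, sub_zero])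
    (by rw [Finsupp.sub_apply, hz.zero, hw])
    (fun j => Submodule.sub_mem _ (hplus j) (mem_plus_of_mem_comp hz'.2 (by push_cast; omega)))
  exact ⟨y, Submodule.mem_top, hy⟩

end Main

end NCForms

theorem mainTheorem11 {k : Type*} [CommRing k] [Algebra ℚ k] {A : Type*} [Ring A] [Algebra k A]
    (hsplit : ∃ ρ : A →ₗ[k] k, ∀ r : k, ρ (algebraMap k A r) = r) :
    (∀ l m : ℤ, Function.Injective (NCForms.toEHC k A l m)) ∧
    (∀ (l : ℤ) (m : ℕ) (hm : 0 < m),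
      ∃ e : NCForms.EHCw k A l m ≃ₗ[k] NCForms.HD k A (l - 2 * m),
        (∀ c, e c = NCForms.piPos k A l m hm c) ∧
        ∀ s : NCForms.DRt k A → NCForms.DRt k A, NCForms.IsSection s →
          ∀ (f : NCForms.DR0 k A)
            (hf : f ∈ LinearMap.ker (NCForms.dDR k A Empty) ⊓
              NCForms.gr k A Empty (l - 2 * m) 0),
            (∀ j : ℕ, NCForms.iDR k A
                ((fun y => s (NCForms.iDR k A y))^[j] (NCForms.incl k A f)) ∈
              (NCForms.plus k A).map (NCForms.dDR k A Unit)) ∧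
            (NCForms.LowersDegree s → ∃ z, NCForms.IsInverseImage s (NCForms.incl k A f) z) ∧
            ∀ z, NCForms.IsInverseImage s (NCForms.incl k A f) z →
              ∃ hz : NCForms.mulUInv k A m z ∈ LinearMap.ker (NCForms.diffU k A) ⊓ ⊤,
                NCForms.Homology.cls ⊤ (NCForms.mulUInv k A m z) hz =
                  NCForms.toEHC k A l m (e.symm (NCForms.Homology.cls _ f hf))) ∧
    (∀ l m : ℤ, m ≤ 0 →
      ∃ e : NCForms.EHCw k A l m ≃ₗ[k] NCForms.HQuot k A l (-m),
        (∀ c, e c = NCForms.piNeg k A l m c) ∧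
        ∀ s : NCForms.DRt k A → NCForms.DRt k A, NCForms.IsSection s →
          ∀ (x : NCForms.DRt k A)
            (hx : (LinearMap.range (NCForms.dDR k A Unit)).mkQ x ∈
              LinearMap.ker (NCForms.iQuot k A) ⊓ NCForms.grQuot k A l (-m)),
            (∀ j : ℕ, NCForms.iDR k A ((fun y => s (NCForms.iDR k A y))^[j] x) ∈
              (NCForms.plus k A).map (NCForms.dDR k A Unit)) ∧
            (NCForms.LowersDegree s → ∃ z, NCForms.IsInverseImage s x z) ∧
            ∀ z, NCForms.IsInverseImage s x z →
              ∃ hz : z ∈ LinearMap.ker (NCForms.diffU k A) ⊓ ⊤,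
                NCForms.Homology.cls ⊤ z hz =
                  NCForms.toEHC k A l m (e.symm (NCForms.Homology.cls _
                    ((LinearMap.range (NCForms.dDR k A Unit)).mkQ x) hx))) := by
  obtain ⟨ρ, hsplit⟩ := hsplit
  have hρ : ρ 1 = 1 := by simpa using hsplit 1
  refine ⟨NCForms.toEHC_injective, fun l m hm => ?_, fun l m hm => ?_⟩
  · refine ⟨LinearEquiv.ofBijective _ (NCForms.piPos_bijective hρ l m hm), fun _ => rfl,
      fun s hs f hf => ?_⟩
    have hx := NCForms.iterate_mem hρ hs (x := NCForms.incl k A f) (by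
      rw [NCForms.dDR_iDR, ← NCForms.incl_dDR, LinearMap.mem_ker.1 hf.1, map_zero, map_zero,
        neg_zero])
    refine ⟨hx, fun hl => NCForms.exists_isInverseImage hl _ hx, fun z hz => ?_⟩
    obtain ⟨w, hw, hwf⟩ := NCForms.exists_cycle_pos hρ hf
    -- The inverse image of `[f]` is replaced by the class of the homogeneous cycle `w` that has `f`
    -- at position `m`.
    rw [(LinearEquiv.symm_apply_eq _).2 (NCForms.piPos_cls_of_eq hm hw hf hwf).symm]
    exact NCForms.cls_mulUInv_eq hρ hm hs hf hz hx hw hwf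
  · refine ⟨LinearEquiv.ofBijective _ (NCForms.piNeg_bijective hρ hm), fun _ => rfl,
      fun s hs x hx => ?_⟩
    obtain ⟨_, _, _, u, hu⟩ := NCForms.exists_of_mkQ_mem hx
    have hx' := NCForms.iterate_mem hρ hs (x := x) (by rw [← hu, NCForms.dDR_dDR])
    refine ⟨hx', fun hl => NCForms.exists_isInverseImage hl _ hx', fun z hz => ?_⟩
    obtain ⟨w, hw, v, hv⟩ := NCForms.exists_cycle_neg hρ hx
    rw [(LinearEquiv.symm_apply_eq _).2 (NCForms.piNeg_cls_of_eq hw hx hv).symm]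
    exact NCForms.cls_eq_toEHC hρ hm hs hz hx' hw hv
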